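/- **Lemma 3.2.** Let $\Sigma$ be a smooth $3$-manifold and $\mathsf M=\mathbb R\times\Sigma$ with Lorentzian metric $g=-\beta^2dt^2+h_t$, where $\beta$ is a smooth positive function on $\mathsf M$ and $h_t$ is a smooth one-parameter family of Riemannian metrics on $\Sigma$ (every globally hyperbolic $4$-manifold is isometric to one of this form). Put $\hat g=\beta^{-2}g=-dt^2+\hat h_t$, $\hat h_t=\beta^{-2}h_t$, and $\Sigma_t=\{t\}\times\Sigma$. Fix a smooth $\hat g$-orthonormal framing $(\partial_t,e_1,e_2,e_3)$ of $\mathsf M$. It determines an orientation and a spin structure of $(\mathsf M,\hat g)$ and trivialises the spinor bundle $\mathsf S\mathsf M$ of $(\mathsf M,\hat g)$, with fibre $\mathbb C^4=\mathbb C^2\oplus\mathbb C^2$, so that $\mathsf S\mathsf M|_{\Sigma_t}=\mathsf S\Sigma_t\oplus\mathsf S\Sigma_t$, where $\mathsf S\Sigma_t$ is the spinor bundle of $(\Sigma,\hat h_t)$. Let * $\hat{\mathsf D}_t=\sum_j\gamma_{\Sigma_t}(e_j)\nabla^{\mathsf S\Sigma_t}_{e_j}$ be the Riemannian Dirac operator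 of $(\Sigma,\hat h_t)$, acting on each summand of $\mathsf S\mathsf M|_{\Sigma_t}=\mathsf S\Sigma_t\oplus\mathsf S\Sigma_t$; * $\wp_{s,t}:\mathsf S\mathsf M|_{\Sigma_t}\to\mathsf S\mathsf M|_{\Sigma_s}$ be the parallel transport along the integral curves of $\partial_t$ for the spin connection of $(\mathsf M,\hat g)$; * $\rho\ge0$ be defined by $d\mathrm{vol}_{(\Sigma,\hat h_t)}=\rho^2\,d\mathrm{vol}_{(\Sigma,\hat h_0)}$, and $V_t\psi=\rho\,\wp_{0,t}\psi$ for sections $\psi$ of $\mathsf S\mathsf M|_{\Sigma_t}$; * $\kappa_{0,t}:\mathsf T^*\mathsf M|_{\Sigma_t}\to\mathsf T^*\mathsf M|_{\Sigma_0}$ be the parallel transport of covectors along the integral curves of $\partial_t$ for the Levi-Civita connection of $\hat g$, where $\mathsf T^*\Sigma_t$ is identified with the covectors in $\mathsf T^*\mathsf M|_{\Sigma_t}$ that annihilate $\partial_t$. Then, for every $t\in\mathbb R$, $V_t$ is invertible with $V_t^{-1}\varphi=\wp_{t,0}(\rho^{-1}\varphi)$, $\kappa_{0,t}$ maps $\mathsf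 T^*\Sigma_t$ into $\mathsf T^*\Sigma_0$, the operators $\hat{\mathsf D}_0$ and $\overline{\mathsf D}_t:=V_t\hat{\mathsf D}_tV_t^{-1}$ are first-order linear differential operators with smooth coefficients on the sections of $\mathsf S\mathsf M|_{\Sigma_0}$ over $\Sigma$, and their principal symbols satisfy $$(\overline{\mathsf D}_t)_{\mathrm{prin}}(x,\eta)=(\hat{\mathsf D}_0)_{\mathrm{prin}}(x,\kappa_{0,t}\eta)\qquad\text{for all }(x,\eta)\in\mathsf T^*\Sigma .$$ Here the principal symbol $\sigma$ of a first-order operator $P$ is normalised by $[P,f]=-i\,\sigma(\cdot,df)$ for smooth real functions $f$ (so $\partial_k$ has symbol $i\eta_k$). -/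

import Mathlib

open Bundle VectorField
open scoped Manifold ContDiff Matrix

noncomputable section

namespace DiracReduction

/-! ### Pseudo-Riemannian geometry: Koszul formula and spin connection -/

section General

variable {E : Type*} [NormedAddCommGroup E] [NormedSpace ℝ E]
  {H : Type*} [TopologicalSpace H] (I : ModelWithCorners ℝ E H)
  {M : Type*} [TopologicalSpace M] [ChartedSpace H M]

/-- Vector fields on `M` (no regularity is imposed here). -/
abbrev VField : Type _ := ∀ x : M, TangentSpace I x

/-- Fields of bilinear forms on the tangent spaces of `M`, for instance (pseudo-)Riemannian
metrics (no regularity is imposed here). -/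
abbrev BilinField : Type _ :=
  ∀ x : M, TangentSpace I x →L[ℝ] TangentSpace I x →L[ℝ] ℝ

/-- Smooth vector fields. -/
def SmoothVField [IsManifold I 1 M] (X : VField I (M := M)) : Prop :=
  ContMDiff I I.tangent ∞ (fun x => (TotalSpace.mk' E x (X x) : TangentBundle I M))

/-- Smooth fields of bilinear forms. -/
def SmoothBilinField [IsManifold I 1 M] (g : BilinField I (M := M)) : Prop :=
  ContMDiff I (I.prod 𝓘(ℝ, E →L[ℝ] E →L[ℝ] ℝ)) ∞
    (fun x => TotalSpace.mk' (E →L[ℝ] E →L[ℝ] ℝ)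
      (E := fun x : M => TangentSpace I x →L[ℝ] TangentSpace I x →L[ℝ] ℝ) x (g x))

/-- The number `g(∇_X Y, Z)` at `x`, where `∇` is the Levi-Civita connection of the
(pseudo-)Riemannian metric `g`, as given by the Koszul formula
`2 g(∇_X Y, Z) = X g(Y,Z) + Y g(Z,X) - Z g(X,Y) + g([X,Y],Z) - g([Y,Z],X) + g([Z,X],Y)`. -/
def leviCivitaForm (g : BilinField I (M := M)) (X Y Z : VField I (M := M)) (x : M) : ℝ :=
  (1 / 2) *
    (mvfderiv I (fun y => g y (Y y) (Z y)) x (X x)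
      + mvfderiv I (fun y => g y (Z y) (X y)) x (Y x)
      - mvfderiv I (fun y => g y (X y) (Y y)) x (Z x)
      + g x (mlieBracket I X Y x) (Z x)
      - g x (mlieBracket I Y Z x) (X x)
      + g x (mlieBracket I Z X x) (Y x))

variable {ι : Type*} [Fintype ι]

/-- The vector field `∇_X Y` for the Levi-Civita connection of `g`, expanded in a
pseudo-orthonormal frame `e` with `g(e_a, e_a) = ε_a ∈ {1, -1}`. -/
def leviCivita (g : BilinField I (M := M)) (ε : ι → ℝ) (e : ι → VField I (M := M))
    (X Y : VField I (M := M)) : VField I (M := M) :=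
  fun x => ∑ a, (ε a * leviCivitaForm I g X Y (e a) x) • e a x

variable {n : Type*} [Fintype n]

/-- The connection matrix of the spin connection in the trivialisation of the spinor bundle
defined by the pseudo-orthonormal frame `e` with signs `ε`:
`(1/4) ∑_{a,b} ε_a ε_b g(∇_X e_a, e_b) γ_a γ_b`.
Here `γ_a` are the matrices of Clifford multiplication by `e_a`, normalised by
`γ_a γ_b + γ_b γ_a = -2 ε_a δ_{ab}`. -/
def spinForm (g : BilinField I (M := M)) (ε : ι → ℝ) (e : ι → VField I (M := M))
    (γ : ι → Matrix n n ℂ) (X : VField I (M := M)) (x : M) : Matrix n n ℂ :=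
  (1 / 4 : ℂ) • ∑ a, ∑ b,
    ((ε a * ε b * leviCivitaForm I g X (e a) (e b) x : ℝ) : ℂ) • (γ a * γ b)

/-- The spin connection `∇_X ψ`, i.e. the lift of the Levi-Civita connection to spinor fields,
in the trivialisation defined by the frame. -/
def spinCov (g : BilinField I (M := M)) (ε : ι → ℝ) (e : ι → VField I (M := M))
    (γ : ι → Matrix n n ℂ) (X : VField I (M := M)) (ψ : M → n → ℂ) (x : M) : n → ℂ :=
  mvfderiv I ψ x (X x) + spinForm I g ε e γ X x *ᵥ ψ x

/-- `P` is a linear differential operator of order `≤ 1` with smooth coefficients, acting on the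
smooth sections of the trivial bundle with fibre `V`, and `σ` is its principal symbol. The
normalisation is that of pseudodifferential calculus: the symbol of `∂_k` is `i η_k`, so that
`[P, f] = -i σ(x, df)` for all real smooth functions `f`. (A linear operator on smooth sections is
a differential operator of order `≤ 1` if and only if all these commutators are of order `0`.)
The operator is only ever evaluated on smooth sections. -/
structure HasPrincipalSymbol {V : Type*} [NormedAddCommGroup V] [NormedSpace ℝ V]
    [NormedSpace ℂ V] [IsScalarTower ℝ ℂ V] (P : (M → V) → (M → V))
    (σ : ∀ x : M, (TangentSpace I x →L[ℝ] ℝ) → (V →ₗ[ℂ] V)) : Prop where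
  contMDiff : ∀ ψ : M → V, ContMDiff I 𝓘(ℝ, V) ∞ ψ → ContMDiff I 𝓘(ℝ, V) ∞ (P ψ)
  map_add : ∀ ψ φ : M → V, ContMDiff I 𝓘(ℝ, V) ∞ ψ → ContMDiff I 𝓘(ℝ, V) ∞ φ →
    P (ψ + φ) = P ψ + P φ
  map_smul : ∀ (c : ℂ) (ψ : M → V), ContMDiff I 𝓘(ℝ, V) ∞ ψ → P (c • ψ) = c • P ψ
  commutator : ∀ (f : M → ℝ) (ψ : M → V), ContMDiff I 𝓘(ℝ, ℝ) ∞ f →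
    ContMDiff I 𝓘(ℝ, V) ∞ ψ → ∀ x : M,
      P (fun y => f y • ψ y) x - f x • P ψ x = -Complex.I • σ x (mvfderiv I f x) (ψ x)

/-- Every covector is the differential of a smooth function. -/
theorem exists_smooth_mvfderiv_eq [FiniteDimensional ℝ E] [I.Boundaryless]
    [IsManifold I ∞ M] [T2Space M] (x : M) (η : TangentSpace I x →L[ℝ] ℝ) :
    ∃ f : M → ℝ, ContMDiff I 𝓘(ℝ,ℝ) ∞ f ∧ mvfderiv I f x = η := by
  have : IsManifold I 1 M := IsManifold.of_le (n := ∞) (by simp)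
  obtain ⟨b⟩ : Nonempty (SmoothBumpFunction I x) := inferInstance
  let η' : E →L[ℝ] ℝ := η
  have h1 : ContMDiffOn I 𝓘(ℝ,ℝ) ∞ (fun y => η' (extChartAt I x y)) (chartAt H x).source :=
    η'.contMDiff.comp_contMDiffOn (contMDiffOn_extChartAt)
  refine ⟨fun y => b y • η' (extChartAt I x y), b.contMDiff_smul h1, ?_⟩
  have he : (fun y => b y • η' (extChartAt I x y)) =ᶠ[nhds x] (fun y => η' (extChartAt I x y)) := by
    filter_upwards [b.eventuallyEq_one] with y hy
    simp [hy]
  have h2 : HasMFDerivAt I 𝓘(ℝ,E) (extChartAt I x) x (mfderiv I 𝓘(ℝ,E) (extChartAt I x) x) :=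
    (mdifferentiableAt_extChartAt (mem_chart_source H x)).hasMFDerivAt
  have h3 := (η'.hasMFDerivAt (x := extChartAt I x x)).comp x h2
  have h4 := h3.congr_of_eventuallyEq he
  ext v
  have h5 := h4.mfderiv
  rw [mfderiv_extChartAt_self] at h5
  simp only [mvfderiv, h5]
  rfl

/-- The principal symbol of an operator is unique. -/
theorem HasPrincipalSymbol.unique [FiniteDimensional ℝ E] [I.Boundaryless]
    [IsManifold I ∞ M] [T2Space M] {V : Type*} [NormedAddCommGroup V] [NormedSpace ℝ V]
    [NormedSpace ℂ V] [IsScalarTower ℝ ℂ V] {P : (M → V) → (M → V)}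
    {σ τ : ∀ x : M, (TangentSpace I x →L[ℝ] ℝ) → (V →ₗ[ℂ] V)}
    (h : HasPrincipalSymbol I P σ) (k : HasPrincipalSymbol I P τ) : σ = τ := by
  funext x η
  ext v
  obtain ⟨f, hf, rfl⟩ := exists_smooth_mvfderiv_eq I x η
  have := (h.commutator f (fun _ => v) hf contMDiff_const x).symm.trans
    (k.commutator f (fun _ => v) hf contMDiff_const x)
  have hI : (-Complex.I) ≠ 0 := by simp
  exact smul_right_injective V hI this
end General

/-! ### Pauli and Dirac matrices -/

/-- The Pauli matrices `σ₁, σ₂, σ₃`. -/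
def pauli : Fin 3 → Matrix (Fin 2) (Fin 2) ℂ :=
  ![!![0, 1; 1, 0], !![0, -Complex.I; Complex.I, 0], !![1, 0; 0, -1]]

/-- Clifford multiplication on `SΣ_t` (fibre `ℂ²`) by the orthonormal frame of `Σ_t`:
`-i σ_j`, which squares to `-1`. -/
def gammaSlice (j : Fin 3) : Matrix (Fin 2) (Fin 2) ℂ := -Complex.I • pauli j

/-- Clifford multiplication on `SM` (fibre `ℂ⁴ = ℂ² ⊕ ℂ²`) by the pseudo-orthonormal frame
`(∂_t, e₁, e₂, e₃)`, in the chiral representation. It satisfies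
`γ_a γ_b + γ_b γ_a = -2 ĝ(e_a, e_b)`. -/
def gammaSpacetime : Fin 4 → Matrix (Fin 2 ⊕ Fin 2) (Fin 2 ⊕ Fin 2) ℂ :=
  Fin.cons (Matrix.fromBlocks 0 1 1 0) (fun j => Matrix.fromBlocks 0 (pauli j) (-pauli j) 0)

/-- The signs of the Lorentzian metric. -/
def lorentzSign : Fin 4 → ℝ := Fin.cons (-1) (fun _ => 1)

/-- The fibre `ℂ⁴ = ℂ² ⊕ ℂ²` of the spinor bundle `SM`. -/
abbrev Spinor : Type := Fin 2 ⊕ Fin 2 → ℂ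

/-! ### The spacetime `M = ℝ × N` -/

/-- The model of the Cauchy hypersurface, a 3-dimensional manifold. -/
abbrev E3 : Type := EuclideanSpace ℝ (Fin 3)

/-- The model with corners of the spacetime `ℝ × N`. Its tangent space at `(t, x)` is
`ℝ × T_x N`, the first factor being spanned by `∂_t`. -/
abbrev IM : ModelWithCorners ℝ (ℝ × E3) (ModelProd ℝ E3) := 𝓘(ℝ, ℝ).prod (𝓡 3)

section Spacetime

variable {N : Type*} [TopologicalSpace N] [ChartedSpace E3 N]

/-- The vector field `∂_t` on `ℝ × N`. -/
def dt : VField IM (M := ℝ × N) := fun _ => ((1, 0) : ℝ × E3)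

/-- A vector tangent to the slice through `p`, seen as a tangent vector of `ℝ × N`. -/
def sliceIncl (p : ℝ × N) : TangentSpace (𝓡 3) p.2 →L[ℝ] TangentSpace IM p :=
  ContinuousLinearMap.inr ℝ ℝ E3

/-- The projection of a tangent vector of `ℝ × N` to the slice. -/
def sliceProj (p : ℝ × N) : TangentSpace IM p →L[ℝ] TangentSpace (𝓡 3) p.2 :=
  ContinuousLinearMap.snd ℝ ℝ E3

/-- The covector `dt` at `p`. -/
def dtCovector (p : ℝ × N) : TangentSpace IM p →L[ℝ] ℝ :=
  ContinuousLinearMap.fst ℝ ℝ E3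

/-- The Lorentzian metric `-a dt² + k_t` on `ℝ × N`. -/
def splitMetric (a : ℝ × N → ℝ)
    (k : ∀ p : ℝ × N, TangentSpace (𝓡 3) p.2 →L[ℝ] TangentSpace (𝓡 3) p.2 →L[ℝ] ℝ) :
    BilinField IM (M := ℝ × N) :=
  fun p => -(a p) • (dtCovector p).smulRight (dtCovector p)
    + ((sliceProj p).precomp ℝ).comp ((k p).comp (sliceProj p))

variable (N) [IsManifold (𝓡 3) ∞ N]

/-- The data of the splitting `(ℝ × N, g = -β² dt² + h_t)`: a smooth positive lapse function `β`
and a one-parameter family of Riemannian metrics `h_t` on `N` such that `g` is smooth. -/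
structure Splitting where
  β : ℝ × N → ℝ
  β_smooth : ContMDiff IM 𝓘(ℝ, ℝ) ∞ β
  β_pos : ∀ p, 0 < β p
  h : ℝ → ContMDiffRiemannianMetric (𝓡 3) ∞ E3 (fun x : N => TangentSpace (𝓡 3) x)
  g_smooth : SmoothBilinField IM
    (splitMetric (fun p => β p ^ 2) (fun p => (h p.1).inner p.2))

variable {N}

namespace Splitting

variable (S : Splitting N)

/-- The conformally rescaled Riemannian metrics `ĥ_t = β⁻² h_t` on `N`. -/
def hHat (t : ℝ) : BilinField (𝓡 3) (M := N) :=
  fun x => (S.β (t, x) ^ 2)⁻¹ • (S.h t).inner x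

/-- The conformally rescaled Lorentzian metric `ĝ = β⁻² g = -dt² + ĥ_t`. -/
def gHat : BilinField IM (M := ℝ × N) :=
  splitMetric (fun _ => 1) (fun p => S.hHat p.1 p.2)

/-- A smooth framing of `(ℝ × N, ĝ)` adapted to the foliation by the slices `Σ_t = {t} × N`:
vector fields `e₁, e₂, e₃` tangent to the slices such that `(∂_t, e₁, e₂, e₃)` is
`ĝ`-orthonormal.

Such a framing determines an orientation and the spin structure
`(ℝ × N) × Spin₀(1,3) → P_SO, (p, s) ↦ (∂_t, e₁, e₂, e₃)(p) · s`, hence a trivialisation of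
the spinor bundle `SM` with fibre `ℂ⁴`, and, in the same way, of `SΣ_t` with fibre `ℂ²`. -/
structure Framing where
  e : Fin 3 → ∀ p : ℝ × N, TangentSpace (𝓡 3) p.2
  smooth : ∀ j, SmoothVField IM (fun p : ℝ × N => sliceIncl p (e j p))
  orthonormal : ∀ p i j, S.hHat p.1 p.2 (e i p) (e j p) = if i = j then 1 else 0

variable {S} (F : S.Framing)

namespace Framing

/-- The framing `(∂_t, e₁, e₂, e₃)` of `(ℝ × N, ĝ)`. -/
def full : Fin 4 → VField IM (M := ℝ × N) :=
  Fin.cons dt (fun j p => sliceIncl p (F.e j p))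

/-- The framing `(e₁, e₂, e₃)` of `(N, ĥ_t)`. -/
def slice (t : ℝ) : Fin 3 → VField (𝓡 3) (M := N) :=
  fun j x => F.e j (t, x)

/-! #### The Riemannian Dirac operators -/

/-- The Riemannian Dirac operator `D̂_t = ∑_j γ_{Σ_t}(e_j) ∇_{e_j}` on the spinor bundle
`SΣ_t` of `(N, ĥ_t)`. -/
def diracSlice (t : ℝ) (φ : N → Fin 2 → ℂ) : N → Fin 2 → ℂ :=
  fun x => ∑ j, gammaSlice j *ᵥ
    spinCov (𝓡 3) (S.hHat t) (fun _ => 1) (F.slice t) gammaSlice (F.slice t j) φ x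

/-- The operator `D̂_t` on sections of `SM|_{Σ_t} = SΣ_t ⊕ SΣ_t`, acting on each summand. -/
def dirac (t : ℝ) (ψ : N → Spinor) : N → Spinor :=
  fun x => Sum.elim
    (F.diracSlice t (fun y a => ψ y (Sum.inl a)) x)
    (F.diracSlice t (fun y a => ψ y (Sum.inr a)) x)

/-! #### Parallel transport of spinors along the integral curves of `∂_t` -/

/-- The curve `u` of spinors over `s ↦ (s, x)` is parallel for the spin connection of
`(ℝ × N, ĝ)`. -/
def IsParallelSpinor (x : N) (u : ℝ → Spinor) : Prop :=
  ∀ s, HasDerivAt u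
    (-(spinForm IM S.gHat lorentzSign F.full gammaSpacetime dt (s, x) *ᵥ u s)) s

/-- The parallel transport `℘_{s,t} : SM|_{(t,x)} → SM|_{(s,x)}` along the integral curve
`s ↦ (s, x)` of `∂_t`: the value at `s` of the parallel spinor whose value at `t` is `v`. -/
def spinTransport (s t : ℝ) (x : N) (v : Spinor) : Spinor :=
  Classical.epsilon fun w => ∃ u, F.IsParallelSpinor x u ∧ u t = v ∧ u s = w

/-- The Riemannian volume density `√det (k(v_i, v_j))` of a metric `k`, evaluated on three
tangent vectors. -/
def volDensity (k : BilinField (𝓡 3) (M := N)) (x : N)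
    (v : Fin 3 → TangentSpace (𝓡 3) x) : ℝ :=
  Real.sqrt (Matrix.det (Matrix.of fun i j => k x (v i) (v j)))

/-- The function `ρ ≥ 0` with `dvol_{Σ_t} = ρ² dvol_{Σ_0}`, where `Σ_t` carries `ĥ_t`. The quotient
of the two densities does not depend on the basis of `T_x N` on which they are evaluated. -/
def rho (t : ℝ) (x : N) : ℝ :=
  Real.sqrt (volDensity (S.hHat t) x (fun j => F.e j (0, x)) /
    volDensity (S.hHat 0) x (fun j => F.e j (0, x)))

/-- The map `V_t ψ = ρ ℘_{0,t} ψ` from sections of `SM|_{Σ_t}` to sections of `SM|_{Σ_0}`. -/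
def V (t : ℝ) (ψ : N → Spinor) : N → Spinor :=
  fun x => F.rho t x • F.spinTransport 0 t x (ψ x)

/-- The inverse `V_t⁻¹ φ = ℘_{t,0} (ρ⁻¹ φ)` of `V_t`. -/
def VInv (t : ℝ) (φ : N → Spinor) : N → Spinor :=
  fun x => F.spinTransport t 0 x ((F.rho t x)⁻¹ • φ x)

/-- The conjugated operator `V_t D̂_t V_t⁻¹` on sections of `SM|_{Σ_0}`. -/
def diracBar (t : ℝ) (φ : N → Spinor) : N → Spinor :=
  F.V t (F.dirac t (F.VInv t φ))

/-! #### Parallel transport of covectors along the integral curves of `∂_t` -/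

/-- The curve `α` of covectors over `s ↦ (s, x)` is parallel for the Levi-Civita connection of
`(ℝ × N, ĝ)`: `∂_s (α(Y)) = α(∇_{∂_t} Y)` for all smooth vector fields `Y`. -/
def IsParallelCovector (x : N)
    (α : ∀ s : ℝ, TangentSpace IM ((s, x) : ℝ × N) →L[ℝ] ℝ) : Prop :=
  ∀ Y : VField IM (M := ℝ × N), SmoothVField IM Y → ∀ s : ℝ,
    HasDerivAt (fun r => α r (Y (r, x)))
      (α s (leviCivita IM S.gHat lorentzSign F.full dt Y (s, x))) s

/-- The parallel transport `κ_{s,t} : T*M|_{(t,x)} → T*M|_{(s,x)}` of covectors along the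
integral curve `s ↦ (s, x)` of `∂_t`. -/
def kappa (s t : ℝ) (x : N) (η : TangentSpace IM ((t, x) : ℝ × N) →L[ℝ] ℝ) :
    TangentSpace IM ((s, x) : ℝ × N) →L[ℝ] ℝ :=
  Classical.epsilon fun ζ => ∃ α : ∀ s : ℝ, TangentSpace IM ((s, x) : ℝ × N) →L[ℝ] ℝ,
    F.IsParallelCovector x α ∧ α t = η ∧ α s = ζ

/-- A covector `η ∈ T*_x N` as a covector at `(t, x)`, annihilating `∂_t`. -/
def liftCovector (t : ℝ) (x : N) (η : TangentSpace (𝓡 3) x →L[ℝ] ℝ) :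
    TangentSpace IM ((t, x) : ℝ × N) →L[ℝ] ℝ :=
  η.comp (sliceProj (t, x))

/-- The restriction to `T_x N` of a covector at `(t, x)`. -/
def restrictCovector (t : ℝ) (x : N) (α : TangentSpace IM ((t, x) : ℝ × N) →L[ℝ] ℝ) :
    TangentSpace (𝓡 3) x →L[ℝ] ℝ :=
  α.comp (sliceIncl (t, x))

/-- The covector `κ_{0,t} η ∈ T*_x Σ_0` for `η ∈ T*_x Σ_t`. -/
def kappaSlice (t : ℝ) (x : N) (η : TangentSpace (𝓡 3) x →L[ℝ] ℝ) :
    TangentSpace (𝓡 3) x →L[ℝ] ℝ :=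
  restrictCovector 0 x (F.kappa 0 t x (liftCovector t x η))

end Framing

end Splitting

end Spacetime

end DiracReduction

end

/-! Conjugating a first-order operator by an invertible bundle map conjugates its principal symbol,
and the scalar `ρ` cancels against `ρ⁻¹`. So the symbol of the conjugated operator at `η` is
`℘_{0,t} ∘ c_t(η) ∘ ℘_{t,0}`, where `c_t(η) = ∑ η(e_j) σ_j` acts on each summand. The equality of
symbols then says that parallel transport intertwines Clifford multiplication by `η` with Clifford
multiplication by `κ_{0,t} η`: if `α` is a parallel covector annihilating `∂_t` and `u` is a
parallel spinor, then `c(α) u` is parallel (`IsParallelSpinor.slash`).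

This rests on two facts. First, `∂_t` is geodesic for `ĝ` (`omega_zero_left`), so the connection
along `∂_t` has no time components: parallel covectors keep annihilating `∂_t`, and the spin
connection matrix is block diagonal, with the same matrix in `𝔰𝔬(3)` acting on both copies of `ℂ²`.
Second, for antisymmetric `w` the commutator of `(1/4) ∑ w_ij σ_i σ_j` with `∑ c_k σ_k` is Clifford
multiplication by `w c` (`pauli_commutator`). With the Leibniz rule, these make the derivative of
`c(α) u` the one prescribed by the spin connection.

The analytic input is the theory of linear ODEs on the whole line: existence and uniqueness make the
transports well defined, and smooth dependence on the integral curve makes `V_t` and its inverse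
preserve smooth sections. Here solutions are obtained by inverting `1 - K` for a Volterra operator
`K` on a Banach space of continuous curves; smooth dependence follows because inversion of bounded
operators is smooth. -/

namespace LinearODE

open MeasureTheory Set

/-! ### Volterra integral equations on a compact interval. -/

section Volterra

variable {F G : Type*} [NormedAddCommGroup F] [NormedSpace ℝ F] [NormedAddCommGroup G]
  [NormedSpace ℝ G]

/-- The compact interval `[-T, T]`, as a type. -/
abbrev Interval (T : NNReal) : Type := Icc (-(T : ℝ)) T

/-- The retraction of the real line onto `[-T, T]`. -/
noncomputable def clamp (T : NNReal) (r : ℝ) : Interval T :=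
  projIcc (-(T : ℝ)) T (by linarith [T.2]) r

lemma continuous_clamp (T : NNReal) : Continuous (clamp T) :=
  continuous_projIcc (h := by linarith [T.2])

lemma clamp_of_mem {T : NNReal} {r : ℝ} (hr : r ∈ Icc (-(T : ℝ)) T) : clamp T r = ⟨r, hr⟩ :=
  projIcc_of_mem _ hr

lemma zero_mem_Icc (T : NNReal) : (0 : ℝ) ∈ Icc (-(T : ℝ)) T := by
  constructor <;> simp

lemma mem_Icc_nnnorm (s : ℝ) : s ∈ Icc (-((‖s‖₊ : NNReal) : ℝ)) ‖s‖₊ := by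
  rw [coe_nnnorm, Real.norm_eq_abs]
  exact ⟨neg_abs_le s, le_abs_self s⟩

lemma uIcc_subset {T : NNReal} {s : ℝ} (hs : s ∈ Icc (-(T : ℝ)) T) :
    uIcc 0 s ⊆ Icc (-(T : ℝ)) T :=
  uIcc_subset_Icc (zero_mem_Icc T) hs

lemma continuous_comp_clamp {X : Type*} [TopologicalSpace X] {T : NNReal}
    (u : C(Interval T, X)) : Continuous (fun r => u (clamp T r)) :=
  u.continuous.comp (continuous_clamp T)

/-- The operator of integration from `0`, on continuous functions on `[-T, T]`. -/
noncomputable def primitive (T : NNReal) : C(Interval T, F) →L[ℝ] C(Interval T, F) :=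
  LinearMap.mkContinuous
    { toFun := fun u => ⟨fun s => ∫ r in (0 : ℝ)..s, u (clamp T r),
        (intervalIntegral.continuous_primitive
          (fun _ _ => (continuous_comp_clamp u).intervalIntegrable _ _) 0).comp
          continuous_subtype_val⟩
      map_add' := fun u v => by
        ext s
        exact intervalIntegral.integral_add ((continuous_comp_clamp u).intervalIntegrable _ _)
          ((continuous_comp_clamp v).intervalIntegrable _ _)
      map_smul' := fun c u => by
        ext s
        exact intervalIntegral.integral_smul c _ } T
    (fun u => by
      refine (ContinuousMap.norm_le _ (by positivity)).2 fun s => ?_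
      refine (intervalIntegral.norm_integral_le_of_norm_le_const
        (fun r _ => u.norm_coe_le_norm (clamp T r))).trans ?_
      rw [mul_comm, sub_zero]
      gcongr
      exact abs_le.2 s.2)

/-- A bilinear map, applied pointwise to continuous functions. -/
noncomputable def pointwise (T : NNReal) (B : G →L[ℝ] F →L[ℝ] F) :
    C(Interval T, G) →L[ℝ] C(Interval T, F) →L[ℝ] C(Interval T, F) :=
  LinearMap.mkContinuous₂ (E := C(Interval T, G)) (F := C(Interval T, F)) (G := C(Interval T, F))
    (LinearMap.mk₂ ℝ (fun (A : C(Interval T, G)) (u : C(Interval T, F)) =>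
        (⟨fun s => B (A s) (u s), (B.continuous.comp A.continuous).clm_apply u.continuous⟩ :
          C(Interval T, F)))
      (fun _ _ _ => by ext; simp) (fun _ _ _ => by ext; simp)
      (fun _ _ _ => by ext; simp) (fun _ _ _ => by ext; simp)) ‖B‖
    (fun A u => by
      refine (ContinuousMap.norm_le _ (by positivity)).2 fun s => ?_
      refine (B.le_opNorm₂ (A s) (u s)).trans ?_
      gcongr
      · exact A.norm_coe_le_norm s
      · exact u.norm_coe_le_norm s)

/-- The Volterra operator `u ↦ ∫₀ˢ B A u`. -/
noncomputable def volterra (T : NNReal) (B : G →L[ℝ] F →L[ℝ] F) :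
    C(Interval T, G) →L[ℝ] C(Interval T, F) →L[ℝ] C(Interval T, F) :=
  (ContinuousLinearMap.compL ℝ _ _ _ (primitive T)).comp (pointwise T B)

lemma volterra_apply {T : NNReal} (B : G →L[ℝ] F →L[ℝ] F) (A : C(Interval T, G))
    (u : C(Interval T, F)) (s : Interval T) :
    volterra T B A u s = ∫ r in (0 : ℝ)..s, B (A (clamp T r)) (u (clamp T r)) := rfl

/-- Each iteration integrates a power of `|r|` once more, which produces the factorial. Keeping the
pointwise factor `|s|`, rather than `T`, is what makes the induction close. -/
lemma norm_volterra_pow_apply_le {T : NNReal} (B : G →L[ℝ] F →L[ℝ] F) (A : C(Interval T, G))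
    (u : C(Interval T, F)) (n : ℕ) (s : Interval T) :
    ‖(volterra T B A ^ n) u s‖ ≤ (‖B‖ * ‖A‖ * |(s : ℝ)|) ^ n / n.factorial * ‖u‖ := by
  induction n generalizing s with
  | zero => simpa using u.norm_coe_le_norm s
  | succ n hn =>
    rw [pow_succ', mul_apply_eq_comp, volterra_apply]
    calc
      _ ≤ ∫ r in uIoc 0 (s : ℝ), (‖B‖ * ‖A‖) ^ (n + 1) * |r - 0| ^ n / n.factorial * ‖u‖ := by
        rw [intervalIntegral.norm_intervalIntegral_eq]
        refine norm_integral_le_of_norm_le (Continuous.integrableOn_uIoc (by fun_prop)) ?_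
        refine (ae_restrict_mem measurableSet_uIoc).mono fun r hr => ?_
        rw [clamp_of_mem (uIcc_subset s.2 (uIoc_subset_uIcc hr))]
        refine ((B.le_opNorm₂ _ _).trans (mul_le_mul (mul_le_mul_of_nonneg_left
          (A.norm_coe_le_norm _) (norm_nonneg B)) (hn _) (norm_nonneg _)
          (by positivity))).trans (le_of_eq ?_)
        simp only [sub_zero]
        ring
      _ = (‖B‖ * ‖A‖ * |(s : ℝ)|) ^ (n + 1) / (n + 1).factorial * ‖u‖ := by
        rw [integral_mul_const, integral_div, integral_const_mul, integral_pow_abs_sub_uIoc,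
          Nat.factorial_succ, mul_pow]
        push_cast
        simp only [sub_zero]
        field_simp
        ring

variable [CompleteSpace F]

/-- Some power of the Volterra operator `K` has norm below one, so `1 - K ^ n` is invertible. It is
the product of `1 - K` with a commuting geometric sum, hence both factors are invertible; no
smallness of `T` or `A` is needed. -/
lemma isUnit_one_sub_volterra {T : NNReal} (B : G →L[ℝ] F →L[ℝ] F) (A : C(Interval T, G)) :
    IsUnit (1 - volterra T B A) := by
  obtain ⟨n, hn⟩ : ∃ n : ℕ, (‖B‖ * ‖A‖ * T) ^ n / n.factorial < 1 :=
    ((FloorSemiring.tendsto_pow_div_factorial_atTop (‖B‖ * ‖A‖ * T)).eventually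
      (gt_mem_nhds zero_lt_one)).exists
  have h : ‖volterra T B A ^ n‖ < 1 := by
    refine lt_of_le_of_lt (ContinuousLinearMap.opNorm_le_bound _ (by positivity) fun u => ?_) hn
    refine (ContinuousMap.norm_le _ (by positivity)).2 fun s => ?_
    refine (norm_volterra_pow_apply_le B A u n s).trans ?_
    gcongr
    exact abs_le.2 s.2
  have h1 : IsUnit (1 - volterra T B A ^ n) :=
    isUnit_one_sub_of_norm_lt_one (R := C(Interval T, F) →L[ℝ] C(Interval T, F)) h
  have h2 := mul_neg_geom_sum (volterra T B A) n
  have h3 := geom_sum_mul_neg (volterra T B A) n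
  have hc : Commute (1 - volterra T B A) (∑ i ∈ Finset.range n, volterra T B A ^ i) := by
    rw [Commute, SemiconjBy, h2, h3]
  rw [← h2] at h1
  exact (hc.isUnit_mul_iff.1 h1).1

/-- The solution on `[-T, T]` of `u' = B A u`, `u 0 = v`. -/
noncomputable def solution {T : NNReal} (B : G →L[ℝ] F →L[ℝ] F) (A : C(Interval T, G)) (v : F) :
    C(Interval T, F) :=
  Ring.inverse (1 - volterra T B A) (ContinuousMap.const _ v)

lemma eq_solution_iff {T : NNReal} (B : G →L[ℝ] F →L[ℝ] F) (A : C(Interval T, G)) (v : F)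
    (u : C(Interval T, F)) :
    u = solution B A v ↔
      ∀ s : Interval T, u s = v + ∫ r in (0 : ℝ)..s, B (A (clamp T r)) (u (clamp T r)) := by
  have hu := isUnit_one_sub_volterra B A
  have h1 : u = solution B A v ↔ (1 - volterra T B A) u = ContinuousMap.const _ v := by
    constructor
    · rintro rfl
      rw [solution, ← mul_apply_eq_comp, Ring.mul_inverse_cancel _ hu]
      rfl
    · intro h
      rw [solution, ← h, ← mul_apply_eq_comp, Ring.inverse_mul_cancel _ hu]
      rfl
  rw [h1, ContinuousMap.ext_iff]
  refine forall_congr' fun s => ?_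
  change u s - volterra T B A u s = v ↔ _
  rw [volterra_apply, sub_eq_iff_eq_add]

end Volterra

/-! ### Global existence and uniqueness for linear ODEs. -/

section Existence

variable {F G : Type*} [NormedAddCommGroup F] [NormedSpace ℝ F] [NormedAddCommGroup G]
  [NormedSpace ℝ G]

/-- The restriction to `[-T, T]` of a continuous function on the real line. -/
def restrict {X : Type*} [TopologicalSpace X] (T : NNReal) {f : ℝ → X} (hf : Continuous f) :
    C(Interval T, X) :=
  ⟨fun s => f s, hf.comp continuous_subtype_val⟩

variable [CompleteSpace F]

lemma hasDerivAt_of_eq_integral (B : G →L[ℝ] F →L[ℝ] F) {A : ℝ → G} (hA : Continuous A) {u : ℝ → F}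
    (hu : Continuous u) {v : F} (h : ∀ s, u s = v + ∫ r in (0 : ℝ)..s, B (A r) (u r)) (s : ℝ) :
    HasDerivAt u (B (A s) (u s)) s := by
  have h1 : Continuous fun r => B (A r) (u r) := (B.continuous.comp hA).clm_apply hu
  have h2 := (intervalIntegral.integral_hasDerivAt_right (h1.intervalIntegrable 0 s)
    h1.stronglyMeasurable.stronglyMeasurableAtFilter h1.continuousAt).const_add v
  exact h2.congr_of_eventuallyEq (Filter.Eventually.of_forall h)

lemma eq_integral_of_hasDerivAt (B : G →L[ℝ] F →L[ℝ] F) {A : ℝ → G} (hA : Continuous A) {u : ℝ → F}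
    (h : ∀ s, HasDerivAt u (B (A s) (u s)) s) (s : ℝ) :
    u s = u 0 + ∫ r in (0 : ℝ)..s, B (A r) (u r) := by
  have hu : Continuous u := continuous_iff_continuousAt.2 fun s => (h s).continuousAt
  rw [intervalIntegral.integral_eq_sub_of_hasDerivAt (fun r _ => h r)
    (((B.continuous.comp hA).clm_apply hu).intervalIntegrable 0 s)]
  abel

/-- Uniqueness on a window: it serves both to glue the solutions on nested windows and to prove
uniqueness on the line. -/
lemma restrict_eq_solution (B : G →L[ℝ] F →L[ℝ] F) {A : ℝ → G} (hA : Continuous A) {u : ℝ → F}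
    (hu : Continuous u) {v : F} (T : NNReal)
    (h : ∀ s ∈ Icc (-(T : ℝ)) T, u s = v + ∫ r in (0 : ℝ)..s, B (A r) (u r)) :
    restrict T hu = solution B (restrict T hA) v := by
  rw [eq_solution_iff]
  intro s
  refine (h s s.2).trans ?_
  congr 1
  refine intervalIntegral.integral_congr fun r hr => ?_
  simp only [clamp_of_mem (uIcc_subset s.2 hr)]
  rfl

/-- A linear ODE with continuous coefficients has global solutions. -/
theorem exists_hasDerivAt (B : G →L[ℝ] F →L[ℝ] F) {A : ℝ → G} (hA : Continuous A) (t : ℝ) (v : F) :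
    ∃ u : ℝ → F, u t = v ∧ ∀ s, HasDerivAt u (B (A s) (u s)) s := by
  -- Translating time reduces to the initial time 0.
  suffices H : ∀ {A : ℝ → G}, Continuous A →
      ∃ u : ℝ → F, u 0 = v ∧ ∀ s, HasDerivAt u (B (A s) (u s)) s by
    obtain ⟨u, h0, hu⟩ := H (A := fun s => A (s + t)) (by fun_prop)
    refine ⟨fun s => u (s - t), by simpa using h0, fun s => ?_⟩
    simpa using (hu (s - t)).comp_sub_const s t
  intro A hA
  let sol : ∀ T : NNReal, C(Interval T, F) := fun T => solution B (restrict T hA) v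
  have sol_eq : ∀ (T : NNReal) (s : ℝ), s ∈ Icc (-(T : ℝ)) T → sol T (clamp T s) =
      v + ∫ r in (0 : ℝ)..s, B (A r) (sol T (clamp T r)) := by
    intro T s hs
    have h := (eq_solution_iff B (restrict T hA) v (sol T)).1 rfl ⟨s, hs⟩
    rw [clamp_of_mem hs, h]
    congr 1
    refine intervalIntegral.integral_congr fun r hr => ?_
    simp only [clamp_of_mem (uIcc_subset hs hr)]
    rfl
  have mono : ∀ {T T' : NNReal}, T ≤ T' → ∀ s ∈ Icc (-(T : ℝ)) T,
      sol T (clamp T s) = sol T' (clamp T' s) := by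
    intro T T' hT s hs
    have hT' : (T : ℝ) ≤ T' := by exact_mod_cast hT
    have h := restrict_eq_solution B hA (continuous_comp_clamp (sol T')) T
      (fun s hs => sol_eq T' s (Icc_subset_Icc (neg_le_neg hT') hT' hs))
    have h' := DFunLike.congr_fun h ⟨s, hs⟩
    rw [clamp_of_mem hs]
    exact h'.symm
  -- The value at `s` is read off on one window containing `s`; by `mono` every other such window
  -- gives the same value.
  let u : ℝ → F := fun s => sol (‖s‖₊ + 1) (clamp _ s)
  have u_eq : ∀ (T : NNReal) (s : ℝ), s ∈ Icc (-(T : ℝ)) T → u s = sol T (clamp T s) := by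
    intro T s hs
    have hs' : s ∈ Icc (-((‖s‖₊ + 1 : NNReal) : ℝ)) (‖s‖₊ + 1 : NNReal) := by
      push_cast
      rw [Real.norm_eq_abs]
      exact ⟨by linarith [neg_abs_le s], by linarith [le_abs_self s]⟩
    exact (mono (le_max_left (‖s‖₊ + 1) T) s hs').trans (mono (le_max_right _ T) s hs).symm
  have u_int : ∀ s, u s = v + ∫ r in (0 : ℝ)..s, B (A r) (u r) := by
    intro s
    have hs : s ∈ Icc (-((‖s‖₊ : NNReal) : ℝ)) ‖s‖₊ := mem_Icc_nnnorm s
    rw [u_eq ‖s‖₊ s hs, sol_eq _ s hs]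
    congr 1
    refine intervalIntegral.integral_congr fun r hr => ?_
    simp only [u_eq ‖s‖₊ r (uIcc_subset hs hr)]
  have u_cont : Continuous u := by
    refine continuous_iff_continuousAt.2 fun s => ?_
    obtain ⟨T, hT⟩ : ∃ T : NNReal, Ioo (-(T : ℝ)) T ∈ nhds s := by
      refine ⟨‖s‖₊ + 1, ?_⟩
      push_cast
      rw [Real.norm_eq_abs]
      exact Ioo_mem_nhds (by linarith [neg_abs_le s]) (by linarith [le_abs_self s])
    refine (continuous_comp_clamp (sol T)).continuousAt.congr ?_
    filter_upwards [hT] with r hr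
    exact (u_eq T r (Ioo_subset_Icc_self hr)).symm
  refine ⟨u, by simpa using u_int 0, hasDerivAt_of_eq_integral B hA u_cont u_int⟩

/-- Two solutions of a linear ODE that agree at one time are equal. -/
theorem hasDerivAt_unique (B : G →L[ℝ] F →L[ℝ] F) {A : ℝ → G} (hA : Continuous A) {u w : ℝ → F} {t : ℝ}
    (hu : ∀ s, HasDerivAt u (B (A s) (u s)) s) (hw : ∀ s, HasDerivAt w (B (A s) (w s)) s)
    (h : u t = w t) : u = w := by
  suffices H : ∀ {A : ℝ → G}, Continuous A → ∀ {u w : ℝ → F},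
      (∀ s, HasDerivAt u (B (A s) (u s)) s) → (∀ s, HasDerivAt w (B (A s) (w s)) s) →
      u 0 = w 0 → u = w by
    have := H (A := fun s => A (s + t)) (by fun_prop) (u := fun s => u (s + t))
      (w := fun s => w (s + t)) (fun s => (hu (s + t)).comp_add_const s t)
      (fun s => (hw (s + t)).comp_add_const s t) (by simpa using h)
    funext s
    simpa using congrFun this (s - t)
  intro A hA u w hu hw h
  funext s
  have hs : s ∈ Icc (-((‖s‖₊ : NNReal) : ℝ)) ‖s‖₊ := mem_Icc_nnnorm s
  have h1 := restrict_eq_solution B hA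
    (continuous_iff_continuousAt.2 fun s => (hu s).continuousAt) ‖s‖₊
    (fun s _ => eq_integral_of_hasDerivAt B hA hu s)
  have h2 := restrict_eq_solution B hA
    (continuous_iff_continuousAt.2 fun s => (hw s).continuousAt) ‖s‖₊
    (fun s _ => eq_integral_of_hasDerivAt B hA hw s)
  rw [← h, ← h1] at h2
  exact (DFunLike.congr_fun h2 ⟨s, hs⟩).symm

end Existence

/-! ### Smooth dependence of solutions on parameters. -/

section Parameters

universe u

variable {E : Type u} [NormedAddCommGroup E] [NormedSpace ℝ E]

set_option synthInstance.maxHeartbeats 200000 in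
/-- A family of functions on a compact space, smooth in a parameter together with its values,
is a smooth function of the parameter for the uniform norm. -/
lemma contDiffOn_curry {K : Type*} [TopologicalSpace K] [CompactSpace K] (n : ℕ) {Ω : Set E}
    (hΩ : IsOpen Ω) {G : Type u} [NormedAddCommGroup G] [NormedSpace ℝ G]
    (f : ℝ × E → G) (hf : ContDiffOn ℝ ∞ f (univ ×ˢ Ω)) (p : K → ℝ) (hp : Continuous p)
    (g : E → C(K, G)) (hg : ∀ y ∈ Ω, ∀ s, g y s = f (p s, y)) :
    ContDiffOn ℝ n g Ω := by
  have hΩ' : IsOpen ((univ : Set ℝ) ×ˢ Ω) := isOpen_univ.prod hΩ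
  induction n generalizing G with
  | zero =>
    refine contDiffOn_zero.2 (continuousOn_iff_continuous_domRestrict.2 ?_)
    refine ContinuousMap.continuous_of_continuous_uncurry _ ?_
    have h1 : Continuous fun q : Ω × K => f (p q.2, (q.1 : E)) :=
      hf.continuousOn.comp_continuous (by fun_prop) (fun q => ⟨mem_univ _, q.1.2⟩)
    exact h1.congr fun q => (hg q.1 q.1.2 q.2).symm
  | succ n ih =>
    -- The partial derivative in the parameter is a family of the same kind with values in `E →L[ℝ]
    -- G`. The induction therefore changes `G`, which is why `E` and `G` share a universe.
    let f' : ℝ × E → E →L[ℝ] G := fun q => (fderiv ℝ f q).comp (ContinuousLinearMap.inr ℝ ℝ E)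
    have hf' : ContDiffOn ℝ ∞ f' (univ ×ˢ Ω) :=
      (hf.fderiv_of_isOpen hΩ' (by simp)).clm_comp contDiffOn_const
    have hfd : ∀ s, ∀ y ∈ Ω, HasFDerivAt (fun z => f (s, z)) (f' (s, y)) y := fun s y hy =>
      ((hf.contDiffAt (hΩ'.mem_nhds ⟨mem_univ _, hy⟩)).differentiableAt
        (by simp)).hasFDerivAt.comp y (hasFDerivAt_prodMk_right s y)
    classical
    let g' : E → C(K, E →L[ℝ] G) := fun y =>
      if hy : y ∈ Ω then ⟨fun s => f' (p s, y),
        hf'.continuousOn.comp_continuous (by fun_prop) (fun q => ⟨mem_univ _, hy⟩)⟩ else 0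
    have hg' : ∀ y ∈ Ω, ∀ s, g' y s = f' (p s, y) := by
      intro y hy s
      simp only [g', dif_pos hy]
      rfl
    have ih' := ih f' hf' g' hg'
    let Φ : C(K, E →L[ℝ] G) →L[ℝ] E →L[ℝ] C(K, G) :=
      LinearMap.mkContinuous₂ (E := C(K, E →L[ℝ] G)) (F := E) (G := C(K, G))
        (LinearMap.mk₂ ℝ (fun (B : C(K, E →L[ℝ] G)) (y : E) =>
          (⟨fun s => B s y, B.continuous.clm_apply continuous_const⟩ : C(K, G)))
          (fun _ _ _ => by ext; rfl) (fun _ _ _ => by ext; rfl)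
          (fun _ _ _ => by ext; simp) (fun _ _ _ => by ext; simp)) 1
        (fun B y => by
          rw [one_mul]
          refine (ContinuousMap.norm_le _ (by positivity)).2 fun s => ?_
          exact ((B s).le_opNorm _).trans
            (mul_le_mul_of_nonneg_right (B.norm_coe_le_norm s) (norm_nonneg _)))
    have hΦ : ∀ B y s, Φ B y s = B s y := fun _ _ _ => rfl
    have hgd : ∀ y ∈ Ω, HasFDerivAt g (Φ (g' y)) y := by
      intro y hy
      refine HasFDerivAt.of_isLittleO ?_
      refine Asymptotics.isLittleO_iff.2 fun c hc => ?_
      have hcont : ContinuousAt g' y := ih'.continuousOn.continuousAt (hΩ.mem_nhds hy)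
      obtain ⟨δ, hδ, hball⟩ := Metric.mem_nhds_iff.1
        (Filter.inter_mem (hΩ.mem_nhds hy) (hcont (Metric.closedBall_mem_nhds (g' y) hc)))
      filter_upwards [Metric.ball_mem_nhds y hδ] with z hz
      refine (ContinuousMap.norm_le _ (by positivity)).2 fun s => ?_
      -- The mean value inequality is applied for each `s` on one ball, chosen by continuity of `g'`
      -- for the uniform norm; the resulting estimate is uniform in `s`.
      have hmv := (convex_ball y δ).norm_image_sub_le_of_norm_hasFDerivWithin_le'
        (f := fun z => f (p s, z)) (f' := fun z => f' (p s, z)) (φ := f' (p s, y)) (C := c)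
        (fun x hx => (hfd (p s) x (hball hx).1).hasFDerivWithinAt)
        (fun x hx => by
          rw [← hg' x (hball hx).1, ← hg' y hy]
          rw [← dist_eq_norm]
          exact (ContinuousMap.dist_apply_le_dist s).trans (hball hx).2)
        (Metric.mem_ball_self hδ) hz
      rw [← hg z (hball hz).1, ← hg y hy, ← hg' y hy, ← hΦ] at hmv
      exact hmv
    refine (contDiffOn_succ_iff_hasFDerivWithinAt_of_uniqueDiffOn hΩ.uniqueDiffOn).2
      ⟨by simp, fun y => Φ (g' y), Φ.contDiff.comp_contDiffOn ih',
        fun y hy => (hgd y hy).hasFDerivWithinAt⟩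

/-- Smoothness of the resolvent of a family of operators. -/
lemma contDiffOn_inverse_one_sub_apply {X Y : Type*} [NormedAddCommGroup X] [NormedSpace ℝ X]
    [NormedAddCommGroup Y] [NormedSpace ℝ Y] [CompleteSpace Y] {Ω : Set E} {g : E → X}
    (hg : ContDiffOn ℝ ∞ g Ω) (L : X →L[ℝ] Y →L[ℝ] Y) (hL : ∀ y ∈ Ω, IsUnit (1 - L (g y)))
    (v : Y) : ContDiffOn ℝ ∞ (fun y => Ring.inverse (1 - L (g y)) v) Ω := by
  intro y hy
  obtain ⟨a, ha⟩ := hL y hy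
  have h1 : ContDiffAt ℝ ∞ (Ring.inverse : (Y →L[ℝ] Y) → _) (1 - L (g y)) := by
    rw [← ha]
    exact contDiffAt_ringInverse ℝ a
  have h2 : ContDiffWithinAt ℝ ∞ (fun z => 1 - L (g z)) Ω y :=
    contDiffWithinAt_const.sub (L.contDiff.comp_contDiffWithinAt (hg y hy))
  exact (h1.comp_contDiffWithinAt y h2).clm_apply contDiffWithinAt_const

variable {F : Type*} [NormedAddCommGroup F] [NormedSpace ℝ F]
  {G : Type u} [NormedAddCommGroup G] [NormedSpace ℝ G]

variable [CompleteSpace F]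

/-- The solution of a linear ODE depends smoothly on parameters on which the coefficients depend
smoothly. -/
theorem contDiffOn_of_hasDerivAt {Ω : Set E} (hΩ : IsOpen Ω) (B : G →L[ℝ] F →L[ℝ] F) {A : ℝ × E → G}
    (hA : ContDiffOn ℝ ∞ A (univ ×ˢ Ω)) {u : E → ℝ → F} {v : F} {t : ℝ}
    (hu : ∀ y ∈ Ω, ∀ s, HasDerivAt (u y) (B (A (s, y)) (u y s)) s) (h0 : ∀ y ∈ Ω, u y t = v)
    (s : ℝ) : ContDiffOn ℝ ∞ (fun y => u y s) Ω := by
  suffices H : ∀ {A : ℝ × E → G}, ContDiffOn ℝ ∞ A (univ ×ˢ Ω) → ∀ {u : E → ℝ → F},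
      (∀ y ∈ Ω, ∀ s, HasDerivAt (u y) (B (A (s, y)) (u y s)) s) → (∀ y ∈ Ω, u y 0 = v) →
      ∀ s : ℝ, ContDiffOn ℝ ∞ (fun y => u y s) Ω by
    have := H (A := fun q => A (q.1 + t, q.2))
      (hA.comp (by fun_prop) (fun q hq => ⟨mem_univ _, hq.2⟩))
      (u := fun y s => u y (s + t)) (fun y hy s => (hu y hy (s + t)).comp_add_const s t)
      (fun y hy => by simpa using h0 y hy) (s - t)
    simpa using this
  clear hu h0 hA s
  intro A hA u hu h0 s
  have hs : s ∈ Icc (-((‖s‖₊ : NNReal) : ℝ)) ‖s‖₊ := mem_Icc_nnnorm s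
  have hAy : ∀ y ∈ Ω, Continuous fun r => A (r, y) := fun y hy =>
    hA.continuousOn.comp_continuous (by fun_prop) (fun q => ⟨mem_univ _, hy⟩)
  classical
  -- The coefficients become a smooth map into a Banach space of curves. The solution at `s` is then
  -- the resolvent at `g y`, applied to a constant curve and evaluated at `s`. The value 0 off `Ω`
  -- is never used.
  let g : E → C(Interval ‖s‖₊, G) := fun y =>
    if hy : y ∈ Ω then restrict ‖s‖₊ (hAy y hy) else 0
  have hg : ContDiffOn ℝ ∞ g Ω := contDiffOn_infty.2 fun n =>
    contDiffOn_curry n hΩ A hA (fun r : Interval ‖s‖₊ => (r : ℝ)) continuous_subtype_val g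
      (fun y hy s => by simp only [g, dif_pos hy]; rfl)
  have hsol : ContDiffOn ℝ ∞ (fun y => solution B (g y) v) Ω :=
    contDiffOn_inverse_one_sub_apply hg (volterra ‖s‖₊ B)
      (fun y _ => isUnit_one_sub_volterra B (g y)) _
  refine ((ContinuousMap.evalCLM ℝ (⟨s, hs⟩ : Interval ‖s‖₊)).contDiff.comp_contDiffOn
    hsol).congr fun y hy => ?_
  have h1 := restrict_eq_solution B (hAy y hy) (v := v)
    (continuous_iff_continuousAt.2 fun s => (hu y hy s).continuousAt) ‖s‖₊
    (fun s _ => by rw [← h0 y hy]; exact eq_integral_of_hasDerivAt B (hAy y hy) (hu y hy) s)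
  have h2 := DFunLike.congr_fun h1 ⟨s, hs⟩
  have h3 : g y = restrict ‖s‖₊ (hAy y hy) := by simp only [g, dif_pos hy]
  change u y s = solution B (g y) v ⟨s, hs⟩
  rw [h3]
  exact h2

end Parameters

end LinearODE

/-! ### Algebraic rules for the Koszul form. -/

namespace DiracReduction

section General

variable {E : Type*} [NormedAddCommGroup E] [NormedSpace ℝ E]
  {H : Type*} [TopologicalSpace H] {I : ModelWithCorners ℝ E H}
  {M : Type*} [TopologicalSpace M] [ChartedSpace H M]

/-- The Levi-Civita connection is metric. -/
lemma leviCivitaForm_add_swap {g : BilinField I (M := M)} (hsymm : ∀ x v w, g x v w = g x w v)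
    (X Y Z : VField I (M := M)) (x : M) :
    leviCivitaForm I g X Y Z x + leviCivitaForm I g X Z Y x =
      mvfderiv I (fun y => g y (Y y) (Z y)) x (X x) := by
  have h : ∀ A B : VField I (M := M), (fun y => g y (A y) (B y)) = fun y => g y (B y) (A y) :=
    fun A B => funext fun y => hsymm _ _ _
  simp only [leviCivitaForm, h Z X, h Y X, h Z Y, mlieBracket_swap_apply (V := Z) (W := X),
    mlieBracket_swap_apply (V := Y) (W := X), mlieBracket_swap_apply (V := Z) (W := Y), map_neg,
    neg_apply]
  ring

variable [IsManifold I ∞ M]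

lemma SmoothVField.mdifferentiableAt {X : VField I (M := M)}
    (hX : SmoothVField I X) (x : M) :
    MDifferentiableAt I I.tangent (fun y => (TotalSpace.mk' E y (X y) : TangentBundle I M)) x :=
  (hX x).mdifferentiableAt (by simp)

lemma SmoothBilinField.apply {g : BilinField I (M := M)}
    (hg : SmoothBilinField I g) {X Y : VField I (M := M)} (hX : SmoothVField I X)
    (hY : SmoothVField I Y) : ContMDiff I 𝓘(ℝ, ℝ) ∞ fun x => g x (X x) (Y x) := by
  intro x
  have : ContMDiffWithinAt I (I.prod 𝓘(ℝ)) ∞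
      (fun m ↦ TotalSpace.mk' ℝ (E := Bundle.Trivial M ℝ) m (g m (X m) (Y m))) Set.univ x := by
    apply ContMDiffWithinAt.clm_bundle_apply₂ (F₁ := E) (F₂ := E)
    · exact (hg x).contMDiffWithinAt
    · exact (hX x).contMDiffWithinAt
    · exact (hY x).contMDiffWithinAt
  simp only [contMDiffWithinAt_totalSpace] at this
  exact contMDiffWithinAt_univ.1 this.2

lemma SmoothVField.mvfderiv_apply {V : Type*} [NormedAddCommGroup V] [NormedSpace ℝ V]
    {X : VField I (M := M)} (hX : SmoothVField I X) {f : M → V}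
    (hf : ContMDiff I 𝓘(ℝ, V) ∞ f) : ContMDiff I 𝓘(ℝ, V) ∞ fun x => mvfderiv I f x (X x) := by
  have h1 : ContMDiff I (𝓘(ℝ, V).tangent) ∞ fun x => tangentMap I 𝓘(ℝ, V) f ⟨x, X x⟩ :=
    (hf.contMDiff_tangentMap (m := ∞) (by simp)).comp hX
  exact (contMDiff_snd_tangentBundle_modelSpace V 𝓘(ℝ, V)).comp h1

lemma SmoothVField.mlieBracket [CompleteSpace E] {X Y : VField I (M := M)}
    (hX : SmoothVField I X) (hY : SmoothVField I Y) :
    SmoothVField I (mlieBracket I X Y) := by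
  have : IsManifold I (((⊤ : ℕ∞) : WithTop ℕ∞) + 1) M := by simpa
  have : IsManifold I (minSmoothness ℝ 2) M := by
    rw [minSmoothness_of_isRCLikeNormedField]
    infer_instance
  exact ContDiff.mlieBracket_vectorField (n := ⊤) (m := ⊤) hX hY (by simp)

lemma SmoothVField.leviCivitaForm [CompleteSpace E] {g : BilinField I (M := M)}
    (hg : SmoothBilinField I g) {X Y Z : VField I (M := M)} (hX : SmoothVField I X)
    (hY : SmoothVField I Y) (hZ : SmoothVField I Z) :
    ContMDiff I 𝓘(ℝ, ℝ) ∞ (leviCivitaForm I g X Y Z) := by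
  have h1 := hX.mvfderiv_apply (hg.apply hY hZ)
  have h2 := hY.mvfderiv_apply (hg.apply hZ hX)
  have h3 := hZ.mvfderiv_apply (hg.apply hX hY)
  have h4 := hg.apply (hX.mlieBracket hY) hZ
  have h5 := hg.apply (hY.mlieBracket hZ) hX
  have h6 := hg.apply (hZ.mlieBracket hX) hY
  exact contMDiff_const.mul (((((h1.add h2).sub h3).add h4).sub h5).add h6)

lemma SmoothVField.smul {X : VField I (M := M)} (hX : SmoothVField I X)
    {f : M → ℝ} (hf : ContMDiff I 𝓘(ℝ, ℝ) ∞ f) : SmoothVField I (f • X) :=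
  ContMDiff.smul_section hf hX

lemma SmoothVField.add {X Y : VField I (M := M)} (hX : SmoothVField I X)
    (hY : SmoothVField I Y) : SmoothVField I (X + Y) :=
  ContMDiff.add_section hX hY

/-- The Leibniz rule for the Levi-Civita connection. -/
lemma leviCivitaForm_smul [CompleteSpace E] {g : BilinField I (M := M)}
    (hsymm : ∀ x v w, g x v w = g x w v)
    (hg : SmoothBilinField I g) {X Y Z : VField I (M := M)} (hX : SmoothVField I X)
    (hY : SmoothVField I Y) (hZ : SmoothVField I Z) {f : M → ℝ} (hf : ContMDiff I 𝓘(ℝ, ℝ) ∞ f)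
    (x : M) :
    leviCivitaForm I g X (f • Y) Z x =
      mvfderiv I f x (X x) * g x (Y x) (Z x) + f x * leviCivitaForm I g X Y Z x := by
  have hf' : MDifferentiableAt I 𝓘(ℝ, ℝ) f x := (hf x).mdifferentiableAt (by simp)
  have h1 : (fun y => g y ((f • Y) y) (Z y)) = f * fun y => g y (Y y) (Z y) := by
    funext y
    simp
  have h2 : (fun y => g y (X y) ((f • Y) y)) = f * fun y => g y (X y) (Y y) := by
    funext y
    simp
  have d : ∀ {A B : VField I (M := M)}, SmoothVField I A → SmoothVField I B →
      MDifferentiableAt I 𝓘(ℝ, ℝ) (fun y => g y (A y) (B y)) x :=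
    fun hA hB => ((hg.apply hA hB) x).mdifferentiableAt (by simp)
  simp only [leviCivitaForm, h1, h2, mvfderiv_mul hf' (d hY hZ), mvfderiv_mul hf' (d hX hY),
    mlieBracket_smul_right hf' (hY.mdifferentiableAt x),
    mlieBracket_smul_left hf' (hY.mdifferentiableAt x)]
  -- The derivative of `f` along `Z` occurs twice, from `Z g(X, fY)` and from `[fY, Z]`; the
  -- symmetry of `g` makes the two terms cancel.
  simp only [Pi.smul_apply', map_smul, map_add, add_apply, smul_apply, smul_eq_mul, hsymm x (Y x) (X x)]
  ring

lemma leviCivitaForm_add [CompleteSpace E] {g : BilinField I (M := M)}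
    (hg : SmoothBilinField I g) {X Y Y' Z : VField I (M := M)} (hX : SmoothVField I X)
    (hY : SmoothVField I Y) (hY' : SmoothVField I Y') (hZ : SmoothVField I Z) (x : M) :
    leviCivitaForm I g X (Y + Y') Z x =
      leviCivitaForm I g X Y Z x + leviCivitaForm I g X Y' Z x := by
  have h1 : (fun y => g y ((Y + Y') y) (Z y)) =
      (fun y => g y (Y y) (Z y)) + fun y => g y (Y' y) (Z y) := by
    funext y
    simp
  have h2 : (fun y => g y (X y) ((Y + Y') y)) =
      (fun y => g y (X y) (Y y)) + fun y => g y (X y) (Y' y) := by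
    funext y
    simp
  have d : ∀ {A B : VField I (M := M)}, SmoothVField I A → SmoothVField I B →
      MDifferentiableAt I 𝓘(ℝ, ℝ) (fun y => g y (A y) (B y)) x :=
    fun hA hB => ((hg.apply hA hB) x).mdifferentiableAt (by simp)
  simp only [leviCivitaForm, h1, h2, mvfderiv_add (d hY hZ) (d hY' hZ),
    mvfderiv_add (d hX hY) (d hX hY'),
    mlieBracket_add_right (hY.mdifferentiableAt x) (hY'.mdifferentiableAt x),
    mlieBracket_add_left (hY.mdifferentiableAt x) (hY'.mdifferentiableAt x)]
  simp only [Pi.add_apply, map_add, add_apply]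
  ring

lemma leviCivitaForm_sum [CompleteSpace E] {g : BilinField I (M := M)}
    (hsymm : ∀ x v w, g x v w = g x w v)
    (hg : SmoothBilinField I g) {X Z : VField I (M := M)} (hX : SmoothVField I X)
    (hZ : SmoothVField I Z) {n : ℕ} {e : Fin n → VField I (M := M)}
    (he : ∀ a, SmoothVField I (e a)) {f : Fin n → M → ℝ}
    (hf : ∀ a, ContMDiff I 𝓘(ℝ, ℝ) ∞ (f a)) (x : M) :
    leviCivitaForm I g X (∑ a, f a • e a) Z x =
      ∑ a, (mvfderiv I (f a) x (X x) * g x (e a x) (Z x) +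
        f a x * leviCivitaForm I g X (e a) Z x) := by
  suffices h : ∀ s : Finset (Fin n), SmoothVField I (∑ a ∈ s, f a • e a) ∧
      leviCivitaForm I g X (∑ a ∈ s, f a • e a) Z x =
      ∑ a ∈ s, (mvfderiv I (f a) x (X x) * g x (e a x) (Z x) +
        f a x * leviCivitaForm I g X (e a) Z x) from (h Finset.univ).2
  classical
  intro s
  induction s using Finset.induction_on with
  | empty =>
    have h0 : SmoothVField I (0 : VField I (M := M)) := contMDiff_zeroSection ℝ (TangentSpace I)
    refine ⟨by simpa using h0, ?_⟩
    -- Vanishing on the zero field is the Leibniz rule with `f = 0`.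
    have := leviCivitaForm_smul hsymm hg hX h0 hZ (f := fun _ => 0) contMDiff_const x
    have h1 : ((fun _ => 0 : M → ℝ) • (0 : VField I (M := M))) = 0 := by
      funext y
      simp
    simpa [h1, mvfderiv_const] using this
  | insert a s ha ih =>
    rw [Finset.sum_insert ha, Finset.sum_insert ha]
    have h1 := (he a).smul (hf a)
    refine ⟨h1.add ih.1, ?_⟩
    rw [leviCivitaForm_add hg hX h1 ih.1 hZ, ih.2, leviCivitaForm_smul hsymm hg hX (he a) hZ (hf a)]

end General

end DiracReduction

/-! ### Lie brackets as commutators, and smoothness of the rescaled metrics. -/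

namespace DiracReduction
section General

variable {E : Type*} [NormedAddCommGroup E] [NormedSpace ℝ E]
  {H : Type*} [TopologicalSpace H] {I : ModelWithCorners ℝ E H}
  {M : Type*} [TopologicalSpace M] [ChartedSpace H M]
variable [IsManifold I ∞ M]

lemma mlieBracket_smul_right_eq [CompleteSpace E] {X Y : VField I (M := M)} (hY : SmoothVField I Y) {f : M → ℝ}
    (hf : ContMDiff I 𝓘(ℝ, ℝ) ∞ f) :
    mlieBracket I X (f • Y) =
      (fun x => mvfderiv I f x (X x)) • Y + f • mlieBracket I X Y := by
  funext x
  exact mlieBracket_smul_right ((hf x).mdifferentiableAt (by simp)) (hY.mdifferentiableAt x)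

/-- The Lie bracket acts on functions as the commutator of derivations. -/
lemma mvfderiv_mlieBracket_smul [CompleteSpace E] {X Y Z : VField I (M := M)}
    (hX : SmoothVField I X) (hY : SmoothVField I Y) (hZ : SmoothVField I Z) {f : M → ℝ}
    (hf : ContMDiff I 𝓘(ℝ, ℝ) ∞ f) (x : M) :
    mvfderiv I f x (mlieBracket I X Y x) • Z x =
      (mvfderiv I (fun y => mvfderiv I f y (Y y)) x (X x) -
        mvfderiv I (fun y => mvfderiv I f y (X y)) x (Y x)) • Z x := by
  have : IsManifold I (minSmoothness ℝ 3) M := by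
    rw [minSmoothness_of_isRCLikeNormedField]
    infer_instance
  have c : ∀ {A : VField I (M := M)}, SmoothVField I A → ContMDiffAt I I.tangent
      (minSmoothness ℝ 2) (fun y => (TotalSpace.mk' E y (A y) : TangentBundle I M)) x := by
    intro A hA
    rw [minSmoothness_of_isRCLikeNormedField]
    exact (hA x).of_le (by norm_cast)
  -- Expand the Jacobi identity for `X`, `Y`, `f • Z`. The mixed terms cancel, the terms with
  -- coefficient `f` cancel by the Jacobi identity for `X`, `Y`, `Z`, and the remaining multiples of
  -- `Z` give the claim.
  have key := leibniz_identity_mlieBracket_apply (c hX) (c hY) (c (hZ.smul hf))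
  have h1 := fun {A : VField I (M := M)} (hA : SmoothVField I A) => hA.mvfderiv_apply hf
  rw [mlieBracket_smul_right_eq hZ hf, mlieBracket_smul_right_eq hZ hf,
    mlieBracket_smul_right_eq hZ hf,
    mlieBracket_add_right ((hZ.smul (h1 hY)).mdifferentiableAt x)
      (((hY.mlieBracket hZ).smul hf).mdifferentiableAt x),
    mlieBracket_add_right ((hZ.smul (h1 hX)).mdifferentiableAt x)
      (((hX.mlieBracket hZ).smul hf).mdifferentiableAt x),
    mlieBracket_smul_right_eq hZ (h1 hY), mlieBracket_smul_right_eq hZ (h1 hX),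
    mlieBracket_smul_right_eq (hY.mlieBracket hZ) hf,
    mlieBracket_smul_right_eq (hX.mlieBracket hZ) hf] at key
  simp only [Pi.add_apply, Pi.smul_apply'] at key
  rw [leibniz_identity_mlieBracket_apply (c hX) (c hY) (c hZ), smul_add] at key
  rw [sub_smul]
  rw [← sub_eq_zero, ← neg_eq_zero, ← sub_eq_zero.2 key]
  abel

set_option synthInstance.maxHeartbeats 400000 in
lemma SmoothBilinField.smul {g : BilinField I (M := M)} (hg : SmoothBilinField I g) {f : M → ℝ}
    (hf : ContMDiff I 𝓘(ℝ, ℝ) ∞ f) : SmoothBilinField I (fun x => f x • g x) :=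
  ContMDiff.smul_section (V := fun x : M => TangentSpace I x →L[ℝ] TangentSpace I x →L[ℝ] ℝ) hf hg

end General
section Spacetime

variable {N : Type*} [TopologicalSpace N] [ChartedSpace E3 N]
lemma splitMetric_apply (a : ℝ × N → ℝ)
    (k : ∀ p : ℝ × N, TangentSpace (𝓡 3) p.2 →L[ℝ] TangentSpace (𝓡 3) p.2 →L[ℝ] ℝ)
    (p : ℝ × N) (v w : TangentSpace IM p) :
    splitMetric a k p v w = - (a p * (dtCovector p v * dtCovector p w)) +
      k p (sliceProj p v) (sliceProj p w) := by
  simp [splitMetric]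

variable [IsManifold (𝓡 3) ∞ N]
variable (S : Splitting N)
namespace Splitting
lemma hHat_symm (t : ℝ) (x : N) (v w : TangentSpace (𝓡 3) x) : S.hHat t x v w = S.hHat t x w v := by
  simp [hHat, (S.h t).symm x v w]

lemma gHat_apply (p : ℝ × N) (v w : TangentSpace IM p) :
    S.gHat p v w = - (dtCovector p v * dtCovector p w) +
      S.hHat p.1 p.2 (sliceProj p v) (sliceProj p w) := by
  rw [gHat, splitMetric_apply, one_mul]

/-- Joint smoothness in time and space is only given for `g`; it passes to `ĝ` because `ĝ = β⁻² g`.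
-/
lemma smoothBilinField_gHat : SmoothBilinField IM S.gHat := by
  have h : S.gHat = fun p => (S.β p ^ 2)⁻¹ •
      splitMetric (fun p => S.β p ^ 2) (fun p => (S.h p.1).inner p.2) p := by
    funext p
    refine ContinuousLinearMap.ext fun v => ContinuousLinearMap.ext fun w => ?_
    have := (S.β_pos p).ne'
    rw [gHat_apply]
    change _ = (S.β p ^ 2)⁻¹ * splitMetric (fun p => S.β p ^ 2) (fun p => (S.h p.1).inner p.2) p v w
    rw [splitMetric_apply]
    change _ + (S.β p ^ 2)⁻¹ * ((S.h p.1).inner p.2 (sliceProj p v) (sliceProj p w)) = _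
    field_simp
  rw [h]
  exact S.g_smooth.smul ((S.β_smooth.pow 2).inv₀ fun p => (pow_pos (S.β_pos p) 2).ne')

lemma smoothBilinField_hHat (t : ℝ) : SmoothBilinField (𝓡 3) (S.hHat t) := by
  refine SmoothBilinField.smul (S.h t).contMDiff ?_
  have h : ContMDiff (𝓡 3) 𝓘(ℝ, ℝ) ∞ fun x : N => S.β (t, x) :=
    S.β_smooth.comp (contMDiff_const.prodMk contMDiff_id)
  exact (h.pow 2).inv₀ fun x => (pow_pos (S.β_pos (t, x)) 2).ne'

end Splitting

lemma smoothVField_dt : SmoothVField IM (dt (N := N)) := by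
  have h0 : ContMDiff (𝓡 3) (𝓡 3).tangent ∞
    (fun x : N => (TotalSpace.mk' E3 x 0 : TangentBundle (𝓡 3) N)) :=
    contMDiff_zeroSection ℝ (TangentSpace (𝓡 3))
  let u : VField 𝓘(ℝ, ℝ) (M := ℝ) := fun _ => (1 : ℝ)
  have h1 : SmoothVField 𝓘(ℝ, ℝ) u := fun x =>
    contMDiffAt_vectorSpace_iff_contDiffAt.2 (contDiffAt_const (c := (1 : ℝ)))
  exact contMDiff_equivTangentBundleProd_symm.comp
    ((h1.comp contMDiff_fst).prodMk (h0.comp contMDiff_snd))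

end Spacetime

/-! ### The adapted framing and the connection along `∂_t`. -/

section Spacetime

variable {N : Type*} [TopologicalSpace N] [ChartedSpace E3 N]

lemma spacetime_ext {p : ℝ × N} {v w : TangentSpace IM p} (h : dtCovector p v = dtCovector p w)
    (h' : sliceProj p v = sliceProj p w) : v = w :=
  Prod.ext h h'

lemma dtCovector_dt (p : ℝ × N) : dtCovector p (dt p) = 1 := rfl

lemma sliceProj_dt (p : ℝ × N) : sliceProj p (dt p) = 0 := rfl

lemma dtCovector_sliceIncl (p : ℝ × N) (v : TangentSpace (𝓡 3) p.2) :
    dtCovector p (sliceIncl p v) = 0 := rfl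

lemma sliceProj_sliceIncl (p : ℝ × N) (v : TangentSpace (𝓡 3) p.2) :
    sliceProj p (sliceIncl p v) = v := rfl

lemma mvfderiv_time (p : ℝ × N) : mvfderiv IM (fun q : ℝ × N => q.1) p = dtCovector p := by
  have := mfderiv_fst (I := 𝓘(ℝ, ℝ)) (I' := 𝓡 3) (x := p)
  ext v
  change mfderiv IM 𝓘(ℝ, ℝ) Prod.fst p v = _
  rw [this]
  rfl

variable [IsManifold (𝓡 3) ∞ N]

/-- The bracket of two fields with constant `∂_t`-component is tangent to the slices. -/
lemma dtCovector_mlieBracket {X Y : VField IM (M := ℝ × N)} (hX : SmoothVField IM X)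
    (hY : SmoothVField IM Y) {a b : ℝ} (hXa : ∀ p, dtCovector p (X p) = a)
    (hYb : ∀ p, dtCovector p (Y p) = b) (p : ℝ × N) :
    dtCovector p (mlieBracket IM X Y p) = 0 := by
  -- Test the bracket on the function `t`: its derivatives along `X` and `Y` are constant, so both
  -- second derivatives vanish. Applying `dt` afterwards removes the auxiliary factor `∂_t`.
  have h := mvfderiv_mlieBracket_smul hX hY smoothVField_dt
    (f := fun q : ℝ × N => q.1) contMDiff_fst p
  simp only [mvfderiv_time, hXa, hYb, mvfderiv_const] at h
  have h' := congrArg (dtCovector p) h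
  simpa [dtCovector_dt] using h'

namespace Splitting

lemma gHat_symm (S : Splitting N) (p : ℝ × N) (v w : TangentSpace IM p) :
    S.gHat p v w = S.gHat p w v := by
  rw [gHat_apply, gHat_apply, hHat_symm, mul_comm]

namespace Framing

variable {S : Splitting N} (F : S.Framing)

lemma full_zero : F.full 0 = dt := rfl

lemma full_succ (j : Fin 3) : F.full j.succ = fun p => sliceIncl p (F.e j p) := rfl

lemma smoothVField_full (a : Fin 4) : SmoothVField IM (F.full a) := by
  refine Fin.cases ?_ (fun j => ?_) a
  · exact smoothVField_dt
  · exact F.smooth j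

lemma smoothVField_slice (t : ℝ) (j : Fin 3) : SmoothVField (𝓡 3) (F.slice t j) := by
  have h1 : ContMDiff (𝓡 3) IM.tangent ∞ fun x : N =>
      (TotalSpace.mk' (ℝ × E3) ((t, x) : ℝ × N) (sliceIncl (t, x) (F.e j (t, x))) :
        TangentBundle IM (ℝ × N)) :=
    (F.smooth j).comp (contMDiff_const.prodMk contMDiff_id)
  have h2 : ContMDiff IM.tangent (𝓡 3).tangent ∞
      (fun v : TangentBundle IM (ℝ × N) => (equivTangentBundleProd 𝓘(ℝ, ℝ) ℝ (𝓡 3) N v).2) :=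
    contMDiff_snd.comp contMDiff_equivTangentBundleProd
  exact h2.comp h1

lemma gHat_full (p : ℝ × N) (a b : Fin 4) :
    S.gHat p (F.full a p) (F.full b p) = if a = b then lorentzSign a else 0 := by
  rw [gHat_apply]
  refine Fin.cases ?_ (fun i => ?_) a <;> refine Fin.cases ?_ (fun j => ?_) b
  · simp [full_zero, dtCovector_dt, sliceProj_dt, lorentzSign]
  · simp [full_zero, full_succ, sliceProj_dt, dtCovector_sliceIncl, (Fin.succ_ne_zero j).symm]
  · simp [full_zero, full_succ, sliceProj_dt, dtCovector_sliceIncl]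
  · simp [full_succ, sliceProj_sliceIncl, dtCovector_sliceIncl, F.orthonormal, lorentzSign]

/-- The expansion of a vector tangent to a slice in the orthonormal frame. -/
lemma slice_expansion (p : ℝ × N) (v : TangentSpace (𝓡 3) p.2) :
    v = ∑ j, S.hHat p.1 p.2 v (F.e j p) • F.e j p := by
  have hli : LinearIndependent ℝ (fun j => F.e j p) := by
    rw [Fintype.linearIndependent_iff]
    intro c hc i
    have h := congrArg (fun w => S.hHat p.1 p.2 w (F.e i p)) hc
    simpa [map_sum, sum_apply, F.orthonormal] using h
  have hcard : Fintype.card (Fin 3) = Module.finrank ℝ (TangentSpace (𝓡 3) p.2) := by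
    change _ = Module.finrank ℝ E3
    simp
  let b := basisOfLinearIndependentOfCardEqFinrank hli hcard
  have hb : ∀ j, b j = F.e j p := fun j => by simp [b]
  have hv := b.sum_repr v
  simp only [hb] at hv
  have hc : ∀ i, S.hHat p.1 p.2 v (F.e i p) = b.repr v i := by
    intro i
    conv_lhs => rw [← hv]
    simp [map_sum, sum_apply, F.orthonormal]
  simp only [hc, hv]

/-- The expansion of a tangent vector in the pseudo-orthonormal frame. -/
lemma full_expansion (p : ℝ × N) (v : TangentSpace IM p) :
    v = ∑ a, (lorentzSign a * S.gHat p v (F.full a p)) • F.full a p := by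
  simp only [gHat_apply]
  rw [Fin.sum_univ_succ]
  simp only [full_zero, full_succ, dtCovector_dt, sliceProj_dt, dtCovector_sliceIncl,
    sliceProj_sliceIncl, map_zero, mul_zero, neg_zero, zero_add, add_zero, mul_one]
  refine spacetime_ext ?_ ?_
  · simp [dtCovector_dt, dtCovector_sliceIncl, lorentzSign]
  · simp only [map_add, map_smul, map_sum, sliceProj_dt, sliceProj_sliceIncl, smul_zero, zero_add]
    simpa [lorentzSign] using F.slice_expansion p (sliceProj p v)

/-- The coefficients `ĝ(∇_{∂_t} e_a, e_b)` of the Levi-Civita connection. -/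
noncomputable def omega (a b : Fin 4) (p : ℝ × N) : ℝ :=
  leviCivitaForm IM S.gHat dt (F.full a) (F.full b) p

lemma contMDiff_omega (a b : Fin 4) : ContMDiff IM 𝓘(ℝ, ℝ) ∞ (F.omega a b) :=
  smoothVField_dt.leviCivitaForm S.smoothBilinField_gHat (F.smoothVField_full a)
    (F.smoothVField_full b)

/-- The connection is metric and the products `ĝ(e_a, e_b)` are constant. -/
lemma omega_swap (a b : Fin 4) (p : ℝ × N) : F.omega b a p = - F.omega a b p := by
  have h := leviCivitaForm_add_swap S.gHat_symm dt (F.full a) (F.full b) p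
  simp only [gHat_full, mvfderiv_const] at h
  exact eq_neg_of_add_eq_zero_right h

lemma exists_dtCovector_full (a : Fin 4) : ∃ c : ℝ, ∀ p, dtCovector p (F.full a p) = c := by
  refine Fin.cases ⟨1, fun p => rfl⟩ (fun j => ⟨0, fun p => rfl⟩) a

lemma gHat_dt (p : ℝ × N) (v : TangentSpace IM p) : S.gHat p v (dt p) = - dtCovector p v := by
  simp [gHat_apply, dtCovector_dt, sliceProj_dt]

/-- This is the geodesic equation `∇_{∂_t} ∂_t = 0`. In the Koszul formula the functions being
differentiated are constant, and `[∂_t, e_b]` is tangent to the slices, hence orthogonal to `∂_t`.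
-/
lemma omega_zero_left (b : Fin 4) (p : ℝ × N) : F.omega 0 b p = 0 := by
  obtain ⟨c, hc⟩ := F.exists_dtCovector_full b
  have h1 := dtCovector_mlieBracket smoothVField_dt (F.smoothVField_full b) dtCovector_dt hc p
  have h2 := dtCovector_mlieBracket (F.smoothVField_full b) smoothVField_dt hc dtCovector_dt p
  have h3 : ∀ p, S.gHat p (dt p) (F.full b p) = if 0 = b then lorentzSign 0 else 0 :=
    fun p => F.gHat_full p 0 b
  have h4 : ∀ p, S.gHat p (F.full b p) (dt p) = if b = 0 then lorentzSign b else 0 :=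
    fun p => F.gHat_full p b 0
  have h5 : ∀ p : ℝ × N, S.gHat p (dt p) (dt p) = -1 := fun p => by rw [gHat_dt, dtCovector_dt]
  simp [omega, leviCivitaForm, full_zero, h3, h4, h5, mvfderiv_const, gHat_dt, h1, h2]

end Framing

end Splitting

end Spacetime

/-! ### Parallel transport of spinors. -/

section Spacetime

/-- The action of a connection matrix on spinors. -/
noncomputable def spinAction : (Fin 4 → Fin 4 → ℝ) →L[ℝ] Spinor →L[ℝ] Spinor :=
  LinearMap.toContinuousLinearMap
    ((LinearMap.toContinuousLinearMap (𝕜 := ℝ) (E := Spinor) (F' := Spinor)).toLinearMap.comp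
    (LinearMap.mk₂ ℝ (fun (w : Fin 4 → Fin 4 → ℝ) (v : Spinor) =>
      -(((1 / 4 : ℂ) • ∑ a, ∑ b, ((lorentzSign a * lorentzSign b * w a b : ℝ) : ℂ) •
        (gammaSpacetime a * gammaSpacetime b)) *ᵥ v))
      (fun w w' v => by
        rw [← neg_add, ← Matrix.add_mulVec, ← smul_add, ← Finset.sum_add_distrib]
        simp only [← Finset.sum_add_distrib, ← add_smul]
        congr! 8
        simp only [Pi.add_apply]
        push_cast
        ring)
      (fun c w v => by
        rw [smul_neg, ← Matrix.smul_mulVec, smul_comm c]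
        congr 3
        simp only [Finset.smul_sum]
        refine Finset.sum_congr rfl fun a _ => Finset.sum_congr rfl fun b _ => ?_
        rw [Pi.smul_apply, Pi.smul_apply, smul_eq_mul, mul_left_comm, Complex.ofReal_mul, mul_smul]
        rfl)
      (fun w v v' => by rw [Matrix.mulVec_add, neg_add])
      (fun c w v => by rw [Matrix.mulVec_smul, smul_neg])))

variable {N : Type*} [TopologicalSpace N] [ChartedSpace E3 N] [IsManifold (𝓡 3) ∞ N]

namespace Splitting

namespace Framing

variable {S : Splitting N} (F : S.Framing)

/-- The matrix of connection coefficients in the direction `∂_t`. -/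
noncomputable def connection (p : ℝ × N) : Fin 4 → Fin 4 → ℝ := fun a b => F.omega a b p

lemma contMDiff_connection : ContMDiff IM 𝓘(ℝ, Fin 4 → Fin 4 → ℝ) ∞ F.connection :=
  contMDiff_pi_space.2 fun a => contMDiff_pi_space.2 fun b => F.contMDiff_omega a b

lemma continuous_connection (x : N) : Continuous fun s => F.connection (s, x) :=
  F.contMDiff_connection.continuous.comp (by fun_prop)

lemma spinAction_connection (p : ℝ × N) (v : Spinor) : spinAction (F.connection p) v =
    -(spinForm IM S.gHat lorentzSign F.full gammaSpacetime dt p *ᵥ v) := rfl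

lemma exists_isParallelSpinor (x : N) (t : ℝ) (v : Spinor) :
    ∃ u, F.IsParallelSpinor x u ∧ u t = v := by
  obtain ⟨u, h0, hu⟩ := LinearODE.exists_hasDerivAt spinAction (F.continuous_connection x) t v
  exact ⟨u, hu, h0⟩

variable {F}

lemma IsParallelSpinor.unique {x : N} {u w : ℝ → Spinor} (hu : F.IsParallelSpinor x u)
    (hw : F.IsParallelSpinor x w) {t : ℝ} (h : u t = w t) : u = w :=
  LinearODE.hasDerivAt_unique spinAction (F.continuous_connection x) hu hw h

/-- Existence makes the choice in `spinTransport` meaningful and uniqueness identifies it.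
Linearity, invertibility and smoothness of the transport are deduced from this. -/
lemma IsParallelSpinor.spinTransport_eq {x : N} {u : ℝ → Spinor} (hu : F.IsParallelSpinor x u)
    (s t : ℝ) : F.spinTransport s t x (u t) = u s := by
  have h : ∃ w u', F.IsParallelSpinor x u' ∧ u' t = u t ∧ u' s = w := ⟨u s, u, hu, rfl, rfl⟩
  obtain ⟨u', h1, h2, h3⟩ := Classical.epsilon_spec h
  rw [spinTransport, ← h3, h1.unique hu h2]

lemma IsParallelSpinor.add {x : N} {u w : ℝ → Spinor} (hu : F.IsParallelSpinor x u)
    (hw : F.IsParallelSpinor x w) : F.IsParallelSpinor x (u + w) := fun s => by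
  have := (hu s).add (hw s)
  rwa [← neg_add, ← Matrix.mulVec_add] at this

lemma IsParallelSpinor.smul {x : N} {u : ℝ → Spinor} (hu : F.IsParallelSpinor x u) (c : ℂ) :
    F.IsParallelSpinor x (c • u) := fun s => by
  have := (hu s).const_smul c
  rwa [smul_neg, ← Matrix.mulVec_smul] at this

variable (F)

/-- Parallel transport of spinors, as a linear map. -/
noncomputable def spinTransportₗ (s t : ℝ) (x : N) : Spinor →ₗ[ℂ] Spinor where
  toFun := F.spinTransport s t x
  map_add' v w := by
    obtain ⟨u, hu, rfl⟩ := F.exists_isParallelSpinor x t v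
    obtain ⟨u', hu', rfl⟩ := F.exists_isParallelSpinor x t w
    rw [hu.spinTransport_eq, hu'.spinTransport_eq]
    exact (hu.add hu').spinTransport_eq s t
  map_smul' c v := by
    obtain ⟨u, hu, rfl⟩ := F.exists_isParallelSpinor x t v
    rw [hu.spinTransport_eq]
    exact (hu.smul c).spinTransport_eq s t

lemma spinTransportₗ_apply (s t : ℝ) (x : N) (v : Spinor) :
    F.spinTransportₗ s t x v = F.spinTransport s t x v := rfl

lemma spinTransport_spinTransport (s t : ℝ) (x : N) (v : Spinor) :
    F.spinTransport t s x (F.spinTransport s t x v) = v := by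
  obtain ⟨u, hu, rfl⟩ := F.exists_isParallelSpinor x t v
  rw [hu.spinTransport_eq, hu.spinTransport_eq]

lemma spinTransport_real_smul (s t : ℝ) (x : N) (c : ℝ) (v : Spinor) :
    F.spinTransport s t x (c • v) = c • F.spinTransport s t x v :=
  (F.spinTransportₗ s t x).map_smul_of_tower c v

/-- The parallel transport of a constant spinor depends smoothly on the integral curve. -/
lemma contMDiff_spinTransport_const (s t : ℝ) (v : Spinor) :
    ContMDiff (𝓡 3) 𝓘(ℝ, Spinor) ∞ fun x : N => F.spinTransport s t x v := by
  intro x₀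
  let φ := extChartAt (𝓡 3) x₀
  -- In a chart of `N` the integral curves of `∂_t` become the parameters of a linear ODE with
  -- smooth coefficients.
  have hA : ContDiffOn ℝ ∞ (fun q : ℝ × E3 => F.connection (q.1, φ.symm q.2))
      (Set.univ ×ˢ φ.target) := by
    rw [← contMDiffOn_iff_contDiffOn]
    refine F.contMDiff_connection.comp_contMDiffOn ?_
    exact contDiff_fst.contMDiff.contMDiffOn.prodMk
      ((contMDiffOn_extChartAt_symm x₀).comp contDiff_snd.contMDiff.contMDiffOn fun q hq => hq.2)
  choose u hu hut using fun x => F.exists_isParallelSpinor x t v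
  have h1 := LinearODE.contDiffOn_of_hasDerivAt (isOpen_extChartAt_target x₀) spinAction hA
    (u := fun y => u (φ.symm y)) (v := v) (t := t) (fun y _ => hu (φ.symm y))
    (fun y _ => hut (φ.symm y)) s
  have h2 : ContMDiffOn (𝓡 3) 𝓘(ℝ, Spinor) ∞ (fun x => u (φ.symm (φ x)) s) φ.source :=
    h1.contMDiffOn.comp (contMDiffOn_extChartAt.mono (extChartAt_source (𝓡 3) x₀).subset)
      fun x hx => φ.map_source hx
  refine (h2.contMDiffAt (extChartAt_source_mem_nhds x₀)).congr_of_eventuallyEq ?_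
  filter_upwards [extChartAt_source_mem_nhds (I := 𝓡 3) x₀] with x hx
  rw [φ.left_inv hx, ← (hu x).spinTransport_eq s t, hut]

/-- Parallel transport maps smooth spinor fields to smooth spinor fields. -/
lemma contMDiff_spinTransport (s t : ℝ) {ψ : N → Spinor} (hψ : ContMDiff (𝓡 3) 𝓘(ℝ, Spinor) ∞ ψ) :
    ContMDiff (𝓡 3) 𝓘(ℝ, Spinor) ∞ fun x : N => F.spinTransport s t x (ψ x) := by
  -- By linearity it suffices to transport the constant basis spinors.
  have h : (fun x : N => F.spinTransport s t x (ψ x)) =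
      fun x => ∑ a, ψ x a • F.spinTransport s t x (Pi.single a 1) := by
    funext x
    simp only [← spinTransportₗ_apply, ← map_smul, ← map_sum]
    congr 1
    exact pi_eq_sum_univ' (ψ x)
  rw [h]
  have hsmul : ContDiff ℝ ∞ fun q : ℂ × Spinor => q.1 • q.2 := contDiff_fst.smul contDiff_snd
  exact ContMDiff.sum fun a _ => hsmul.contMDiff.comp
    ((contMDiff_pi_space.1 hψ a).prodMk_space (F.contMDiff_spinTransport_const s t _))

end Framing

end Splitting

end Spacetime

/-! ### Smoothness, linearity and the Leibniz rule for the spin connection. -/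

section General

variable {E : Type*} [NormedAddCommGroup E] [NormedSpace ℝ E]
  {H : Type*} [TopologicalSpace H] {I : ModelWithCorners ℝ E H}
  {M : Type*} [TopologicalSpace M] [ChartedSpace H M]

lemma contMDiff_mulVec {m n : Type*} [Fintype m] [Fintype n] (A : Matrix m n ℂ) {φ : M → n → ℂ}
    (hφ : ContMDiff I 𝓘(ℝ, n → ℂ) ∞ φ) : ContMDiff I 𝓘(ℝ, m → ℂ) ∞ fun x => A *ᵥ φ x :=
  (LinearMap.toContinuousLinearMap (A.mulVecLin.restrictScalars ℝ)).contDiff.contMDiff.comp hφ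

lemma contMDiff_complex_smul {V : Type*} [NormedAddCommGroup V] [NormedSpace ℝ V]
    [NormedSpace ℂ V] [IsScalarTower ℝ ℂ V] (c : ℂ) {φ : M → V}
    (hφ : ContMDiff I 𝓘(ℝ, V) ∞ φ) : ContMDiff I 𝓘(ℝ, V) ∞ fun x => c • φ x :=
  (contDiff_id.const_smul c).contMDiff.comp hφ

lemma mvfderiv_complex_smul {V : Type*} [NormedAddCommGroup V] [NormedSpace ℝ V]
    [NormedSpace ℂ V] [IsScalarTower ℝ ℂ V] (c : ℂ) {φ : M → V}
    (hφ : ContMDiff I 𝓘(ℝ, V) ∞ φ) (x : M) (v : TangentSpace I x) :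
    mvfderiv I (c • φ) x v = c • mvfderiv I φ x v := by
  let L : V →L[ℝ] V := c • ContinuousLinearMap.id ℝ V
  have h1 : HasMFDerivAt I 𝓘(ℝ, V) φ x (mfderiv I 𝓘(ℝ, V) φ x) :=
    ((hφ x).mdifferentiableAt (by simp)).hasMFDerivAt
  have h2 := ((L.hasMFDerivAt (x := φ x)).comp x h1).mfderiv
  change mfderiv I 𝓘(ℝ, V) (L ∘ φ) x v = _
  rw [h2]
  rfl

lemma contMDiff_sqrt {f : M → ℝ} (hf : ContMDiff I 𝓘(ℝ, ℝ) ∞ f) (h0 : ∀ x, f x ≠ 0) :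
    ContMDiff I 𝓘(ℝ, ℝ) ∞ fun x => Real.sqrt (f x) := fun x =>
  (Real.contDiffAt_sqrt (h0 x)).contMDiffAt.comp x (hf x)

variable {ι : Type*} [Fintype ι] {n : Type*} [Fintype n]

lemma spinForm_mulVec (g : BilinField I (M := M)) (ε : ι → ℝ) (e : ι → VField I (M := M))
    (γ : ι → Matrix n n ℂ) (X : VField I (M := M)) (x : M) (v : n → ℂ) :
    spinForm I g ε e γ X x *ᵥ v = (1 / 4 : ℂ) • ∑ a, ∑ b,
      (ε a * ε b * leviCivitaForm I g X (e a) (e b) x) • ((γ a * γ b) *ᵥ v) := by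
  simp only [spinForm, Matrix.smul_mulVec, Matrix.sum_mulVec, Complex.coe_smul]

/-- The spin connection maps smooth spinor fields to smooth spinor fields. -/
lemma contMDiff_spinCov [CompleteSpace E] [IsManifold I ∞ M] {g : BilinField I (M := M)}
    (hg : SmoothBilinField I g) (ε : ι → ℝ) {e : ι → VField I (M := M)}
    (he : ∀ a, SmoothVField I (e a)) (γ : ι → Matrix n n ℂ) {X : VField I (M := M)}
    (hX : SmoothVField I X) {ψ : M → n → ℂ} (hψ : ContMDiff I 𝓘(ℝ, n → ℂ) ∞ ψ) :
    ContMDiff I 𝓘(ℝ, n → ℂ) ∞ (spinCov I g ε e γ X ψ) := by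
  refine (hX.mvfderiv_apply hψ).add ?_
  simp only [spinForm_mulVec]
  refine contMDiff_complex_smul _ (ContMDiff.sum fun a _ => ContMDiff.sum fun b _ => ?_)
  exact (contMDiff_const.mul (hX.leviCivitaForm hg (he a) (he b))).smul (contMDiff_mulVec _ hψ)

lemma spinCov_add (g : BilinField I (M := M)) (ε : ι → ℝ) (e : ι → VField I (M := M))
    (γ : ι → Matrix n n ℂ) (X : VField I (M := M)) {ψ φ : M → n → ℂ}
    (hψ : ContMDiff I 𝓘(ℝ, n → ℂ) ∞ ψ) (hφ : ContMDiff I 𝓘(ℝ, n → ℂ) ∞ φ) (x : M) :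
    spinCov I g ε e γ X (ψ + φ) x = spinCov I g ε e γ X ψ x + spinCov I g ε e γ X φ x := by
  rw [spinCov, mvfderiv_add ((hψ x).mdifferentiableAt (by simp))
    ((hφ x).mdifferentiableAt (by simp)), Pi.add_apply, Matrix.mulVec_add, add_apply, spinCov,
    spinCov]
  abel

lemma spinCov_complex_smul (g : BilinField I (M := M)) (ε : ι → ℝ) (e : ι → VField I (M := M))
    (γ : ι → Matrix n n ℂ) (X : VField I (M := M)) (c : ℂ) {ψ : M → n → ℂ}
    (hψ : ContMDiff I 𝓘(ℝ, n → ℂ) ∞ ψ) (x : M) :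
    spinCov I g ε e γ X (c • ψ) x = c • spinCov I g ε e γ X ψ x := by
  rw [spinCov, mvfderiv_complex_smul c hψ, Pi.smul_apply, Matrix.mulVec_smul, spinCov, smul_add]

/-- The Leibniz rule for the spin connection. -/
lemma spinCov_smul (g : BilinField I (M := M)) (ε : ι → ℝ) (e : ι → VField I (M := M))
    (γ : ι → Matrix n n ℂ) (X : VField I (M := M)) {f : M → ℝ} {ψ : M → n → ℂ}
    (hf : ContMDiff I 𝓘(ℝ, ℝ) ∞ f) (hψ : ContMDiff I 𝓘(ℝ, n → ℂ) ∞ ψ) (x : M) :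
    spinCov I g ε e γ X (fun y => f y • ψ y) x =
      f x • spinCov I g ε e γ X ψ x + mvfderiv I f x (X x) • ψ x := by
  rw [spinCov, mvfderiv_fun_smul ((hf x).mdifferentiableAt (by simp))
    ((hψ x).mdifferentiableAt (by simp)), Matrix.mulVec_smul, spinCov, smul_add, add_apply]
  simp only [smul_apply, ContinuousLinearMap.smulRight_apply]
  abel

end General

/-- Clifford multiplication on `SΣ_t ⊕ SΣ_t` by the covector with components `c`, up to the
factor `i`. -/
noncomputable def slash (c : Fin 3 → ℝ) : Spinor →ₗ[ℂ] Spinor :=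
  ∑ j, (c j : ℂ) • (Matrix.fromBlocks (pauli j) 0 0 (pauli j)).mulVecLin

lemma slash_apply (c : Fin 3 → ℝ) (v : Spinor) : slash c v = ∑ j, c j •
    (Sum.elim (pauli j *ᵥ (v ∘ Sum.inl)) (pauli j *ᵥ (v ∘ Sum.inr)) : Spinor) := by
  simp [slash, Matrix.fromBlocks_mulVec]

/-! ### The principal symbol of the Riemannian Dirac operator. -/

section Spacetime

variable {N : Type*} [TopologicalSpace N] [ChartedSpace E3 N] [IsManifold (𝓡 3) ∞ N]

namespace Splitting

namespace Framing

variable {S : Splitting N} (F : S.Framing)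

lemma contMDiff_diracSlice (t : ℝ) {φ : N → Fin 2 → ℂ}
    (hφ : ContMDiff (𝓡 3) 𝓘(ℝ, Fin 2 → ℂ) ∞ φ) :
    ContMDiff (𝓡 3) 𝓘(ℝ, Fin 2 → ℂ) ∞ (F.diracSlice t φ) :=
  ContMDiff.sum fun j _ => contMDiff_mulVec _ (contMDiff_spinCov (S.smoothBilinField_hHat t) _
    (F.smoothVField_slice t) _ (F.smoothVField_slice t j) hφ)

/-- The connection matrix commutes with `f`, so only the derivatives along the frame contribute. The
`-i` in `gammaSlice` is exactly the `-i` of the symbol normalisation, so the symbol contains bare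
Pauli matrices. -/
lemma diracSlice_smul (t : ℝ) {f : N → ℝ} {φ : N → Fin 2 → ℂ}
    (hf : ContMDiff (𝓡 3) 𝓘(ℝ, ℝ) ∞ f) (hφ : ContMDiff (𝓡 3) 𝓘(ℝ, Fin 2 → ℂ) ∞ φ) (x : N) :
    F.diracSlice t (fun y => f y • φ y) x = f x • F.diracSlice t φ x +
      -Complex.I • ∑ j, mvfderiv (𝓡 3) f x (F.e j (t, x)) • (pauli j *ᵥ φ x) := by
  simp only [diracSlice, spinCov_smul _ _ _ _ _ hf hφ, Matrix.mulVec_add, Matrix.mulVec_smul,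
    Finset.sum_add_distrib, Finset.smul_sum]
  congr 1
  refine Finset.sum_congr rfl fun j _ => ?_
  rw [smul_comm (-Complex.I)]
  exact congrArg _ (Matrix.smul_mulVec _ _ _)

/-- The principal symbol of the Riemannian Dirac operator. -/
noncomputable def diracSymbol (t : ℝ) (x : N) (η : TangentSpace (𝓡 3) x →L[ℝ] ℝ) :
    Spinor →ₗ[ℂ] Spinor :=
  slash fun j => η (F.e j (t, x))

theorem hasPrincipalSymbol_dirac (t : ℝ) :
    HasPrincipalSymbol (𝓡 3) (F.dirac t) (F.diracSymbol t) where
  contMDiff ψ hψ := by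
    have h := contMDiff_pi_space.1 hψ
    have h1 := contMDiff_pi_space.1 (F.contMDiff_diracSlice t (φ := fun y a => ψ y (Sum.inl a))
      (contMDiff_pi_space.2 fun a => h _))
    have h2 := contMDiff_pi_space.1 (F.contMDiff_diracSlice t (φ := fun y a => ψ y (Sum.inr a))
      (contMDiff_pi_space.2 fun a => h _))
    refine contMDiff_pi_space.2 fun a => ?_
    cases a with
    | inl a => exact h1 a
    | inr a => exact h2 a
  map_add ψ φ hψ hφ := by
    have h := contMDiff_pi_space.1 hψ
    have h' := contMDiff_pi_space.1 hφ
    have key : ∀ i : Fin 2 → Fin 2 ⊕ Fin 2, F.diracSlice t (fun y a => (ψ + φ) y (i a)) =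
        F.diracSlice t (fun y a => ψ y (i a)) + F.diracSlice t (fun y a => φ y (i a)) := by
      intro i
      funext x
      change F.diracSlice t ((fun y a => ψ y (i a)) + fun y a => φ y (i a)) x = _
      simp only [diracSlice, Pi.add_apply, ← Finset.sum_add_distrib, ← Matrix.mulVec_add]
      refine Finset.sum_congr rfl fun j _ => ?_
      rw [← spinCov_add _ _ _ _ _ (contMDiff_pi_space.2 fun a => h _)
        (contMDiff_pi_space.2 fun a => h' _)]
    funext x a
    cases a with
    | inl a => exact congrFun (congrFun (key Sum.inl) x) a
    | inr a => exact congrFun (congrFun (key Sum.inr) x) a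
  map_smul c ψ hψ := by
    have h := contMDiff_pi_space.1 hψ
    have key : ∀ i : Fin 2 → Fin 2 ⊕ Fin 2, F.diracSlice t (fun y a => (c • ψ) y (i a)) =
        c • F.diracSlice t (fun y a => ψ y (i a)) := by
      intro i
      funext x
      change F.diracSlice t (c • fun y a => ψ y (i a)) x = _
      simp only [diracSlice, Pi.smul_apply, Finset.smul_sum, ← Matrix.mulVec_smul]
      refine Finset.sum_congr rfl fun j _ => ?_
      rw [← spinCov_complex_smul _ _ _ _ _ c (contMDiff_pi_space.2 fun a => h _)]
    funext x a
    cases a with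
    | inl a => exact congrFun (congrFun (key Sum.inl) x) a
    | inr a => exact congrFun (congrFun (key Sum.inr) x) a
  commutator f ψ hf hψ x := by
    have h := contMDiff_pi_space.1 hψ
    have key := fun i : Fin 2 → Fin 2 ⊕ Fin 2 => F.diracSlice_smul t (f := f)
      (φ := fun y a => ψ y (i a)) hf (contMDiff_pi_space.2 fun a => h _) x
    rw [sub_eq_iff_eq_add', diracSymbol, slash_apply]
    funext a
    cases a with
    | inl a =>
      refine (congrFun (key Sum.inl) a).trans ?_
      simp only [dirac, Pi.add_apply, Pi.smul_apply, Finset.sum_apply, Sum.elim_inl]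
      rfl
    | inr a =>
      refine (congrFun (key Sum.inr) a).trans ?_
      simp only [dirac, Pi.add_apply, Pi.smul_apply, Finset.sum_apply, Sum.elim_inr]
      rfl

end Framing

end Splitting

end Spacetime

/-! ### The volume density, the map `V_t` and the conjugated operator. -/

section Spacetime

variable {N : Type*} [TopologicalSpace N] [ChartedSpace E3 N] [IsManifold (𝓡 3) ∞ N]

namespace Splitting

namespace Framing

variable {S : Splitting N} (F : S.Framing)

/-- The Gram matrix for `ĥ_t` of the frame at time `0`. -/
noncomputable def gram (t : ℝ) (x : N) : Matrix (Fin 3) (Fin 3) ℝ :=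
  Matrix.of fun i j => S.hHat t x (F.e i (0, x)) (F.e j (0, x))

lemma hHat_eq_sum (t : ℝ) (x : N) (v w : TangentSpace (𝓡 3) x) :
    S.hHat t x v w = ∑ k, S.hHat t x v (F.e k (t, x)) * S.hHat t x w (F.e k (t, x)) := by
  conv_lhs => rw [F.slice_expansion (t, x) v]
  simp only [map_sum, map_smul, sum_apply, smul_apply, smul_eq_mul]
  exact Finset.sum_congr rfl fun k _ => by rw [S.hHat_symm t x w]

/-- The Gram matrix is `P * Pᵀ`, with `P` the change of basis from the frame at time `t` to the
frame at time 0. The opposite change of basis `Q` inverts `P`. -/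
lemma det_gram_pos (t : ℝ) (x : N) : 0 < (F.gram t x).det := by
  let P : Matrix (Fin 3) (Fin 3) ℝ := Matrix.of fun i k => S.hHat t x (F.e i (0, x)) (F.e k (t, x))
  let Q : Matrix (Fin 3) (Fin 3) ℝ := Matrix.of fun k i => S.hHat 0 x (F.e k (t, x)) (F.e i (0, x))
  have h1 : F.gram t x = P * Pᵀ := by
    ext i j
    rw [Matrix.mul_apply]
    exact F.hHat_eq_sum t x _ _
  have h2 : Q * P = 1 := by
    ext k l
    rw [Matrix.mul_apply, Matrix.one_apply, ← F.orthonormal (t, x)]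
    conv_rhs => rw [F.slice_expansion (0, x) (F.e k (t, x))]
    simp only [map_sum, map_smul, sum_apply, smul_apply, smul_eq_mul]
    rfl
  have h3 : P.det ≠ 0 := by
    intro h
    have := congrArg Matrix.det h2
    rw [Matrix.det_mul, h, mul_zero, Matrix.det_one] at this
    exact zero_ne_one this
  rw [h1, Matrix.det_mul, Matrix.det_transpose]
  exact mul_self_pos.2 h3

lemma gram_zero (x : N) : F.gram 0 x = 1 := by
  ext i j
  rw [Matrix.one_apply]
  exact F.orthonormal (0, x) i j

/-- The densities are evaluated on the frame at time 0, which is orthonormal for `ĥ_0`, so the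
denominator is 1. -/
lemma rho_eq (t : ℝ) (x : N) : F.rho t x = Real.sqrt (Real.sqrt (F.gram t x).det) := by
  have h : volDensity (S.hHat 0) x (fun j => F.e j (0, x)) = Real.sqrt (F.gram 0 x).det := rfl
  rw [rho, h, gram_zero, Matrix.det_one, Real.sqrt_one, div_one]
  rfl

lemma rho_pos (t : ℝ) (x : N) : 0 < F.rho t x := by
  rw [rho_eq]
  exact Real.sqrt_pos.2 (Real.sqrt_pos.2 (F.det_gram_pos t x))

lemma contMDiff_rho (t : ℝ) : ContMDiff (𝓡 3) 𝓘(ℝ, ℝ) ∞ (F.rho t) := by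
  have hg : ∀ i j, ContMDiff (𝓡 3) 𝓘(ℝ, ℝ) ∞ fun x => F.gram t x i j := fun i j =>
    (S.smoothBilinField_hHat t).apply (F.smoothVField_slice 0 i) (F.smoothVField_slice 0 j)
  have hdet : ContMDiff (𝓡 3) 𝓘(ℝ, ℝ) ∞ fun x => (F.gram t x).det := by
    simp only [Matrix.det_apply']
    exact ContMDiff.sum fun σ _ => contMDiff_const.mul (contMDiff_finsetProd fun i _ => hg _ _)
  have h := contMDiff_sqrt (contMDiff_sqrt hdet fun x => (F.det_gram_pos t x).ne')
    fun x => (Real.sqrt_pos.2 (F.det_gram_pos t x)).ne'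
  exact h.congr fun x => F.rho_eq t x

lemma leftInverse_VInv (t : ℝ) : Function.LeftInverse (F.VInv t) (F.V t) := by
  intro ψ
  funext x
  rw [VInv, V, smul_smul, inv_mul_cancel₀ (F.rho_pos t x).ne', one_smul,
    spinTransport_spinTransport]

lemma rightInverse_VInv (t : ℝ) : Function.RightInverse (F.VInv t) (F.V t) := by
  intro ψ
  funext x
  rw [V, VInv, spinTransport_spinTransport, smul_smul, mul_inv_cancel₀ (F.rho_pos t x).ne',
    one_smul]

lemma contMDiff_V (t : ℝ) {ψ : N → Spinor} (hψ : ContMDiff (𝓡 3) 𝓘(ℝ, Spinor) ∞ ψ) :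
    ContMDiff (𝓡 3) 𝓘(ℝ, Spinor) ∞ (F.V t ψ) :=
  (F.contMDiff_rho t).smul (F.contMDiff_spinTransport 0 t hψ)

lemma contMDiff_VInv (t : ℝ) {ψ : N → Spinor} (hψ : ContMDiff (𝓡 3) 𝓘(ℝ, Spinor) ∞ ψ) :
    ContMDiff (𝓡 3) 𝓘(ℝ, Spinor) ∞ (F.VInv t ψ) :=
  F.contMDiff_spinTransport t 0 (((F.contMDiff_rho t).inv₀ fun x => (F.rho_pos t x).ne').smul hψ)

lemma V_apply (t : ℝ) (ψ : N → Spinor) (x : N) :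
    F.V t ψ x = (F.rho t x : ℂ) • F.spinTransportₗ 0 t x (ψ x) := by
  rw [Complex.coe_smul]
  rfl

lemma VInv_apply (t : ℝ) (ψ : N → Spinor) (x : N) :
    F.VInv t ψ x = ((F.rho t x)⁻¹ : ℂ) • F.spinTransportₗ t 0 x (ψ x) := by
  rw [← Complex.ofReal_inv, Complex.coe_smul]
  exact F.spinTransport_real_smul t 0 x _ _

/-- The principal symbol of the conjugated Dirac operator. -/
noncomputable def diracBarSymbol (t : ℝ) (x : N) (η : TangentSpace (𝓡 3) x →L[ℝ] ℝ) :
    Spinor →ₗ[ℂ] Spinor :=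
  F.spinTransportₗ 0 t x ∘ₗ F.diracSymbol t x η ∘ₗ F.spinTransportₗ t 0 x

/-- `V_t` and its inverse act fibrewise and linearly, so they commute with multiplication by `f`.
The commutator with `f` is therefore conjugated like the operator itself, and the factors `ρ` and
`ρ⁻¹` cancel. -/
theorem hasPrincipalSymbol_diracBar (t : ℝ) :
    HasPrincipalSymbol (𝓡 3) (F.diracBar t) (F.diracBarSymbol t) where
  contMDiff ψ hψ := F.contMDiff_V t ((F.hasPrincipalSymbol_dirac t).contMDiff _
    (F.contMDiff_VInv t hψ))
  map_add ψ φ hψ hφ := by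
    have h : F.VInv t (ψ + φ) = F.VInv t ψ + F.VInv t φ := by
      funext x
      simp only [Pi.add_apply, VInv_apply, map_add, smul_add]
    rw [diracBar, h, (F.hasPrincipalSymbol_dirac t).map_add _ _ (F.contMDiff_VInv t hψ)
      (F.contMDiff_VInv t hφ)]
    funext x
    simp only [diracBar, Pi.add_apply, V_apply, map_add, smul_add]
  map_smul c ψ hψ := by
    have h : F.VInv t (c • ψ) = c • F.VInv t ψ := by
      funext x
      simp only [Pi.smul_apply, VInv_apply, map_smul]
      rw [smul_comm]
    rw [diracBar, h, (F.hasPrincipalSymbol_dirac t).map_smul _ _ (F.contMDiff_VInv t hψ)]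
    funext x
    simp only [diracBar, Pi.smul_apply, V_apply, map_smul]
    rw [smul_comm]
  commutator f ψ hf hψ x := by
    have h : F.VInv t (fun y => f y • ψ y) = fun y => f y • F.VInv t ψ y := by
      funext y
      simp only [VInv_apply, ← Complex.coe_smul (f y), map_smul]
      rw [smul_comm]
    have key := (F.hasPrincipalSymbol_dirac t).commutator f _ hf (F.contMDiff_VInv t hψ) x
    rw [sub_eq_iff_eq_add] at key
    rw [diracBar, h, V_apply, key, VInv_apply, diracBar, V_apply]
    have hρ : (F.rho t x : ℂ) ≠ 0 := Complex.ofReal_ne_zero.2 (F.rho_pos t x).ne'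
    simp only [← Complex.coe_smul (f x), map_add, map_smul, smul_add, diracBarSymbol,
      LinearMap.comp_apply]
    rw [smul_comm (F.rho t x : ℂ) (-Complex.I), smul_smul (F.rho t x : ℂ), mul_inv_cancel₀ hρ,
      one_smul, smul_comm (F.rho t x : ℂ), add_sub_cancel_right]

end Framing

end Splitting

end Spacetime

/-! ### The spin representation of `𝔰𝔬(3)` and Clifford multiplication. -/

lemma spinAction_eq {w : Fin 4 → Fin 4 → ℝ} (hw : ∀ a b, w b a = - w a b)
    (h0 : ∀ b, w 0 b = 0) (v : Spinor) :
    spinAction w v = (1 / 4 : ℂ) • ∑ i : Fin 3, ∑ j : Fin 3, (w i.succ j.succ : ℂ) •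
      (Matrix.fromBlocks (pauli i * pauli j) 0 0 (pauli i * pauli j) *ᵥ v) := by
  have h0' : ∀ b, w b 0 = 0 := fun b => by rw [hw, h0, neg_zero]
  have h : spinAction w v = -(((1 / 4 : ℂ) • ∑ a, ∑ b, ((lorentzSign a * lorentzSign b * w a b : ℝ) : ℂ) •
        (gammaSpacetime a * gammaSpacetime b)) *ᵥ v) := rfl
  -- This sign cancels the one in the equation of parallel transport, and the off-diagonal chiral
  -- blocks multiply to a diagonal matrix with equal blocks.
  have hγ : ∀ i j : Fin 3, gammaSpacetime i.succ * gammaSpacetime j.succ =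
      -Matrix.fromBlocks (pauli i * pauli j) 0 0 (pauli i * pauli j) := by
    intro i j
    simp [gammaSpacetime, Matrix.fromBlocks_multiply, Matrix.fromBlocks_neg]
  rw [h]
  simp only [Fin.sum_univ_succ (n := 3), h0, h0', hγ, lorentzSign, Fin.cons_succ, mul_zero,
    Complex.ofReal_zero, zero_smul, Finset.sum_const_zero, zero_add, one_mul, smul_neg,
    Finset.sum_neg_distrib, Matrix.neg_mulVec, neg_neg, Matrix.smul_mulVec, Matrix.sum_mulVec]

/-- The Clifford relations give `[σ_i σ_j, σ_k] = 2 δ_jk σ_i - 2 δ_ik σ_j`; summed against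
antisymmetric `w` the two terms agree, and `1/4` normalises their sum. The proof checks entries
after reducing `w` to its three independent coefficients. -/
lemma pauli_commutator {w : Fin 3 → Fin 3 → ℂ} (hw : ∀ a b, w b a = - w a b) (c : Fin 3 → ℂ) :
    (1 / 4 : ℂ) • ((∑ i, ∑ j, w i j • (pauli i * pauli j)) * ∑ k, c k • pauli k) =
      (∑ i, (∑ j, w i j * c j) • pauli i) +
      (1 / 4 : ℂ) • ((∑ k, c k • pauli k) * ∑ i, ∑ j, w i j • (pauli i * pauli j)) := by
  have hd : ∀ i, w i i = 0 := fun i => by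
    have := hw i i
    linear_combination (1 / 2 : ℂ) * this
  simp only [Fin.sum_univ_three, hd, hw 0 1, hw 0 2, hw 1 2]
  ext a b
  fin_cases a <;> fin_cases b <;>
    simp [pauli] <;> ring_nf <;> simp <;> ring_nf

lemma spinAction_comp {w : Fin 4 → Fin 4 → ℝ} (hw : ∀ a b, w b a = - w a b)
    (h0 : ∀ b, w 0 b = 0) (v : Spinor) {i : Fin 2 → Fin 2 ⊕ Fin 2}
    (hi : i = Sum.inl ∨ i = Sum.inr) :
    spinAction w v ∘ i = ((1 / 4 : ℂ) • ∑ j : Fin 3, ∑ k : Fin 3, (w j.succ k.succ : ℂ) •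
      (pauli j * pauli k)) *ᵥ (v ∘ i) := by
  rw [spinAction_eq hw h0]
  funext a
  rcases hi with rfl | rfl <;>
    simp only [Function.comp_apply, Matrix.fromBlocks_mulVec, Matrix.smul_mulVec,
      Matrix.sum_mulVec, Pi.smul_apply, Finset.sum_apply, Sum.elim_inl, Sum.elim_inr,
      Matrix.zero_mulVec, add_zero, zero_add]

lemma slash_comp (c : Fin 3 → ℝ) (v : Spinor) {i : Fin 2 → Fin 2 ⊕ Fin 2}
    (hi : i = Sum.inl ∨ i = Sum.inr) :
    slash c v ∘ i = (∑ j, (c j : ℂ) • pauli j) *ᵥ (v ∘ i) := by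
  rw [slash_apply]
  funext a
  rcases hi with rfl | rfl <;>
    simp only [Function.comp_apply, Matrix.smul_mulVec, Matrix.sum_mulVec, Pi.smul_apply,
      Finset.sum_apply, Sum.elim_inl, Sum.elim_inr, Complex.coe_smul]

/-- The compatibility of the spin representation of `𝔰𝔬(3)` with Clifford multiplication. -/
lemma slash_spinAction {w : Fin 4 → Fin 4 → ℝ} (hw : ∀ a b, w b a = - w a b)
    (h0 : ∀ b, w 0 b = 0) (c : Fin 3 → ℝ) (v : Spinor) :
    spinAction w (slash c v) =
      slash (fun i => ∑ j : Fin 3, w i.succ j.succ * c j) v + slash c (spinAction w v) := by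
  have key : ∀ i : Fin 2 → Fin 2 ⊕ Fin 2, i = Sum.inl ∨ i = Sum.inr →
      spinAction w (slash c v) ∘ i =
        slash (fun i => ∑ j : Fin 3, w i.succ j.succ * c j) v ∘ i +
          slash c (spinAction w v) ∘ i := by
    intro i hi
    have h := pauli_commutator (w := fun j k => (w j.succ k.succ : ℂ))
      (fun a b => by rw [hw a.succ b.succ, Complex.ofReal_neg]) (fun k => (c k : ℂ))
    rw [spinAction_comp hw h0 _ hi, slash_comp _ _ hi, slash_comp _ _ hi, slash_comp _ _ hi,
      spinAction_comp hw h0 _ hi, Matrix.mulVec_mulVec, Matrix.mulVec_mulVec, ← Matrix.add_mulVec,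
      Matrix.smul_mul, Matrix.mul_smul, h]
    push_cast
    rfl
  funext a
  cases a with
  | inl a => exact congrFun (key _ (Or.inl rfl)) a
  | inr a => exact congrFun (key _ (Or.inr rfl)) a

/-- The Leibniz rule for Clifford multiplication. -/
lemma hasDerivAt_slash {c : ℝ → Fin 3 → ℝ} {c' : Fin 3 → ℝ} {u : ℝ → Spinor} {u' : Spinor} {s : ℝ}
    (hc : HasDerivAt c c' s) (hu : HasDerivAt u u' s) :
    HasDerivAt (fun r => slash (c r) (u r)) (slash c' (u s) + slash (c s) u') s := by
  have hM : ∀ j, HasDerivAt (fun r => Matrix.fromBlocks (pauli j) 0 0 (pauli j) *ᵥ u r)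
      (Matrix.fromBlocks (pauli j) 0 0 (pauli j) *ᵥ u') s := fun j =>
    (LinearMap.toContinuousLinearMap ((Matrix.fromBlocks (pauli j) 0 0
      (pauli j)).mulVecLin.restrictScalars ℝ)).hasFDerivAt.comp_hasDerivAt s hu
  have h := HasDerivAt.fun_sum (u := Finset.univ)
    fun j _ => (hasDerivAt_pi.1 hc j).smul (hM j)
  rw [Finset.sum_add_distrib] at h
  rw [add_comm]
  exact h

/-- The components of the covector equation of parallel transport. -/
noncomputable def covectorAction : (Fin 4 → Fin 4 → ℝ) →L[ℝ] (Fin 4 → ℝ) →L[ℝ] (Fin 4 → ℝ) :=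
  LinearMap.toContinuousLinearMap
    ((LinearMap.toContinuousLinearMap (𝕜 := ℝ) (E := Fin 4 → ℝ) (F' := Fin 4 → ℝ)).toLinearMap.comp
    (LinearMap.mk₂ ℝ (fun (w : Fin 4 → Fin 4 → ℝ) (c : Fin 4 → ℝ) (a : Fin 4) =>
      ∑ b, lorentzSign b * w a b * c b)
      (fun w w' c => by
        funext a
        simp only [Pi.add_apply, mul_add, add_mul, Finset.sum_add_distrib])
      (fun r w c => by
        funext a
        simp only [Pi.smul_apply, smul_eq_mul, Finset.mul_sum]
        exact Finset.sum_congr rfl fun b _ => by ring)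
      (fun w c c' => by
        funext a
        simp only [Pi.add_apply, mul_add, Finset.sum_add_distrib])
      (fun r w c => by
        funext a
        simp only [Pi.smul_apply, smul_eq_mul, Finset.mul_sum]
        exact Finset.sum_congr rfl fun b _ => by ring)))

lemma covectorAction_apply (w : Fin 4 → Fin 4 → ℝ) (c : Fin 4 → ℝ) (a : Fin 4) :
    covectorAction w c a = ∑ b, lorentzSign b * w a b * c b := rfl

lemma lorentzSign_mul_self (a : Fin 4) : lorentzSign a * lorentzSign a = 1 := by
  refine Fin.cases ?_ (fun j => ?_) a <;> simp [lorentzSign]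

/-! ### Parallel transport of covectors and comparison of the symbols. -/

section Spacetime

variable {N : Type*} [TopologicalSpace N] [ChartedSpace E3 N]

/-- The derivative of a function along an integral curve of `∂_t`. -/
lemma hasDerivAt_time {f : ℝ × N → ℝ} (hf : ContMDiff IM 𝓘(ℝ, ℝ) ∞ f) (x : N) (s : ℝ) :
    HasDerivAt (fun r => f (r, x)) (mvfderiv IM f (s, x) (dt (s, x))) s := by
  have h1 : HasMFDerivAt IM 𝓘(ℝ, ℝ) f (s, x) (mfderiv IM 𝓘(ℝ, ℝ) f (s, x)) :=
    ((hf (s, x)).mdifferentiableAt (by simp)).hasMFDerivAt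
  have h2 : HasMFDerivAt 𝓘(ℝ, ℝ) IM (fun r : ℝ => (r, x)) s
      (ContinuousLinearMap.inl ℝ ℝ E3) := by
    have h3 : MDifferentiableAt 𝓘(ℝ, ℝ) IM (fun r : ℝ => (r, x)) s :=
      mdifferentiableAt_id.prodMk mdifferentiableAt_const
    have h4 := h3.hasMFDerivAt
    rw [mfderiv_prod_left] at h4
    exact h4
  let L : ℝ × E3 →L[ℝ] ℝ := mfderiv IM 𝓘(ℝ, ℝ) f (s, x)
  have h5 : HasFDerivAt (fun r => f (r, x)) (L.comp (ContinuousLinearMap.inl ℝ ℝ E3)) s :=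
    hasMFDerivAt_iff_hasFDerivAt.1 (h1.comp s h2)
  exact h5.hasDerivAt

lemma tangent_decomposition (p : ℝ × N) (v : TangentSpace IM p) :
    v = dtCovector p v • dt p + sliceIncl p (sliceProj p v) := by
  refine spacetime_ext ?_ ?_ <;>
    simp [dtCovector_dt, sliceProj_dt, dtCovector_sliceIncl, sliceProj_sliceIncl]

lemma lift_restrict {t : ℝ} {x : N} {α : TangentSpace IM ((t, x) : ℝ × N) →L[ℝ] ℝ}
    (h : α (dt (t, x)) = 0) :
    Splitting.Framing.liftCovector t x (Splitting.Framing.restrictCovector t x α) = α := by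
  refine ContinuousLinearMap.ext fun v => ?_
  conv_rhs => rw [tangent_decomposition (t, x) v]
  rw [map_add, map_smul, h, smul_zero, zero_add]
  rfl

variable [IsManifold (𝓡 3) ∞ N]

namespace Splitting

namespace Framing

variable {S : Splitting N} (F : S.Framing)

lemma leviCivita_full (a : Fin 4) (p : ℝ × N) :
    leviCivita IM S.gHat lorentzSign F.full dt (F.full a) p =
      ∑ b, (lorentzSign b * F.omega a b p) • F.full b p := rfl

/-- The components of the covariant derivative along `∂_t` in the frame. -/
lemma leviCivitaForm_dt {Y : VField IM (M := ℝ × N)} (hY : SmoothVField IM Y) (b : Fin 4)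
    (p : ℝ × N) :
    leviCivitaForm IM S.gHat dt Y (F.full b) p =
      mvfderiv IM (fun q => lorentzSign b * S.gHat q (Y q) (F.full b q)) p (dt p) * lorentzSign b +
      ∑ a, lorentzSign a * S.gHat p (Y p) (F.full a p) * F.omega a b p := by
  have hc : ∀ a, ContMDiff IM 𝓘(ℝ, ℝ) ∞ fun q => lorentzSign a * S.gHat q (Y q) (F.full a q) :=
    fun a => contMDiff_const.mul (S.smoothBilinField_gHat.apply hY (F.smoothVField_full a))
  have hsum : Y = ∑ a, (fun q => lorentzSign a * S.gHat q (Y q) (F.full a q)) • F.full a := by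
    funext q
    rw [Finset.sum_apply]
    exact F.full_expansion q (Y q)
  conv_lhs => rw [hsum]
  rw [leviCivitaForm_sum S.gHat_symm S.smoothBilinField_gHat smoothVField_dt
    (F.smoothVField_full b) F.smoothVField_full hc, Finset.sum_add_distrib]
  congr 1
  simp only [gHat_full, mul_ite, mul_zero]
  rw [Finset.sum_ite_eq' Finset.univ b]
  simp

/-- Solve the ODE for the components `α(e_a)` and rebuild `α` from the dual frame, whose signs are
those of the metric. Expanding an arbitrary `Y` in the frame reduces the parallel condition to the
Leibniz rule `leviCivitaForm_dt`. -/
lemma exists_isParallelCovector (x : N) (t : ℝ) (η : TangentSpace IM ((t, x) : ℝ × N) →L[ℝ] ℝ) :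
    ∃ α : ∀ s : ℝ, TangentSpace IM ((s, x) : ℝ × N) →L[ℝ] ℝ,
      F.IsParallelCovector x α ∧ α t = η := by
  obtain ⟨c, hct, hc⟩ := LinearODE.exists_hasDerivAt covectorAction (F.continuous_connection x) t
    (fun a => η (F.full a (t, x)))
  let α : ∀ s : ℝ, TangentSpace IM ((s, x) : ℝ × N) →L[ℝ] ℝ := fun s =>
    ∑ a, (c s a * lorentzSign a) • S.gHat (s, x) (F.full a (s, x))
  have hα : ∀ s v, α s v = ∑ a, lorentzSign a * S.gHat (s, x) v (F.full a (s, x)) * c s a := by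
    intro s v
    simp only [α, sum_apply, smul_apply, smul_eq_mul]
    exact Finset.sum_congr rfl fun a _ => by rw [S.gHat_symm]; ring
  refine ⟨α, fun Y hY s => ?_, ?_⟩
  · let y : Fin 4 → ℝ × N → ℝ := fun a q => lorentzSign a * S.gHat q (Y q) (F.full a q)
    have hy : ∀ a, ContMDiff IM 𝓘(ℝ, ℝ) ∞ (y a) := fun a =>
      contMDiff_const.mul (S.smoothBilinField_gHat.apply hY (F.smoothVField_full a))
    have hd := HasDerivAt.fun_sum (u := Finset.univ) fun a _ =>
      (hasDerivAt_time (hy a) x s).mul (hasDerivAt_pi.1 (hc s) a)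
    have hfun : (fun r => α r (Y (r, x))) = fun r => ∑ a, y a (r, x) * c r a :=
      funext fun r => hα r _
    have hαe : ∀ b, α s (F.full b (s, x)) = c s b := by
      intro b
      rw [hα]
      simp [gHat_full, lorentzSign_mul_self]
    rw [hfun]
    convert! hd using 1
    rw [leviCivita, map_sum]
    simp only [map_smul, smul_eq_mul, hαe, F.leviCivitaForm_dt hY, Finset.sum_add_distrib,
      covectorAction_apply, mul_add, add_mul, Finset.mul_sum, Finset.sum_mul]
    congr 1
    · refine Finset.sum_congr rfl fun b _ => ?_
      rw [mul_left_comm, lorentzSign_mul_self, mul_one]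
    · rw [Finset.sum_comm]
      refine Finset.sum_congr rfl fun a _ => Finset.sum_congr rfl fun b _ => ?_
      simp only [connection, y]
      ring
  · refine ContinuousLinearMap.ext fun v => ?_
    rw [hα, hct]
    conv_rhs => rw [F.full_expansion (t, x) v]
    simp only [map_sum, map_smul, smul_eq_mul]

variable {F}

/-- Testing on the frame fields alone already gives a closed linear ODE for the components; this
yields uniqueness. -/
lemma IsParallelCovector.hasDerivAt {x : N}
    {α : ∀ s : ℝ, TangentSpace IM ((s, x) : ℝ × N) →L[ℝ] ℝ} (hα : F.IsParallelCovector x α)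
    (s : ℝ) : HasDerivAt (fun r a => α r (F.full a (r, x)))
      (covectorAction (F.connection (s, x)) fun a => α s (F.full a (s, x))) s := by
  refine hasDerivAt_pi.2 fun a => ?_
  have h := hα (F.full a) (F.smoothVField_full a) s
  rw [leviCivita_full, map_sum] at h
  simp only [map_smul, smul_eq_mul] at h
  exact h

lemma IsParallelCovector.kappa_eq {x : N}
    {α : ∀ s : ℝ, TangentSpace IM ((s, x) : ℝ × N) →L[ℝ] ℝ} (hα : F.IsParallelCovector x α)
    (s t : ℝ) : F.kappa s t x (α t) = α s := by
  have h : ∃ ζ, ∃ α' : ∀ s : ℝ, TangentSpace IM ((s, x) : ℝ × N) →L[ℝ] ℝ,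
    F.IsParallelCovector x α' ∧ α' t = α t ∧ α' s = ζ := ⟨α s, α, hα, rfl, rfl⟩
  obtain ⟨α', h1, h2, h3⟩ := Classical.epsilon_spec h
  rw [kappa, ← h3]
  have h4 := LinearODE.hasDerivAt_unique covectorAction (F.continuous_connection x) (t := t)
    h1.hasDerivAt hα.hasDerivAt (by rw [h2])
  refine ContinuousLinearMap.ext fun v => ?_
  rw [F.full_expansion (s, x) v]
  simp only [map_sum, map_smul]
  exact Finset.sum_congr rfl fun a _ => congrArg _ (congrFun (congrFun h4 s) a)

/-- A parallel covector that annihilates `∂_t` at one time does so at all times. -/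
lemma IsParallelCovector.apply_dt {x : N}
    {α : ∀ s : ℝ, TangentSpace IM ((s, x) : ℝ × N) →L[ℝ] ℝ} (hα : F.IsParallelCovector x α)
    {t : ℝ} (ht : α t (dt (t, x)) = 0) (s : ℝ) : α s (dt (s, x)) = 0 := by
  have h : ∀ r, HasDerivAt (fun r => α r (F.full 0 (r, x))) 0 r := fun r => by
    have := hasDerivAt_pi.1 (hα.hasDerivAt r) 0
    rw [covectorAction_apply] at this
    simpa [connection, omega_zero_left] using this
  have h' := is_const_of_deriv_eq_zero (fun r => (h r).differentiableAt) (fun r => (h r).deriv) s t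
  exact h'.trans ht

/-- Clifford multiplication by a parallel covector preserves parallel spinors. -/
lemma IsParallelSpinor.slash {x : N} {α : ∀ s : ℝ, TangentSpace IM ((s, x) : ℝ × N) →L[ℝ] ℝ}
    (hα : F.IsParallelCovector x α) (h0 : ∀ s, α s (dt (s, x)) = 0) {u : ℝ → Spinor}
    (hu : F.IsParallelSpinor x u) : F.IsParallelSpinor x fun s =>
      slash (fun j => α s (sliceIncl (s, x) (F.e j (s, x)))) (u s) := by
  intro s
  have key := slash_spinAction (w := F.connection (s, x)) (fun a b => F.omega_swap a b (s, x))
    (fun b => F.omega_zero_left b (s, x)) (fun j => α s (sliceIncl (s, x) (F.e j (s, x)))) (u s)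
  -- Since `α` annihilates `∂_t`, only spatial components enter, and their derivative is the vector
  -- `w c` produced by `slash_spinAction`.
  have hc : HasDerivAt (fun r (j : Fin 3) => α r (sliceIncl (r, x) (F.e j (r, x))))
      (fun i : Fin 3 => ∑ j : Fin 3, F.connection (s, x) i.succ j.succ *
        α s (sliceIncl (s, x) (F.e j (s, x)))) s := by
    refine hasDerivAt_pi.2 fun i => ?_
    have h := hasDerivAt_pi.1 (hα.hasDerivAt s) i.succ
    rw [covectorAction_apply, Fin.sum_univ_succ, full_zero, h0, mul_zero, zero_add] at h
    simpa only [lorentzSign, Fin.cons_succ, one_mul] using! h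
  have h := hasDerivAt_slash hc (hu s)
  rw [← spinAction_connection, ← key] at h
  exact h

variable (F)

lemma exists_isParallelCovector_lift (t : ℝ) (x : N) (η : TangentSpace (𝓡 3) x →L[ℝ] ℝ) :
    ∃ α : ∀ s : ℝ, TangentSpace IM ((s, x) : ℝ × N) →L[ℝ] ℝ, F.IsParallelCovector x α ∧
      α t = liftCovector t x η ∧ (∀ s, α s (dt (s, x)) = 0) := by
  obtain ⟨α, hα, ht⟩ := F.exists_isParallelCovector x t (liftCovector t x η)
  refine ⟨α, hα, ht, hα.apply_dt (t := t) ?_⟩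
  rw [ht, liftCovector, ContinuousLinearMap.comp_apply, sliceProj_dt, map_zero]

/-- The transported covector still annihilates `∂_t`, so restricting it to the slice loses nothing.
-/
lemma lift_kappaSlice (t : ℝ) (x : N) (η : TangentSpace (𝓡 3) x →L[ℝ] ℝ) :
    liftCovector 0 x (F.kappaSlice t x η) = F.kappa 0 t x (liftCovector t x η) := by
  obtain ⟨α, hα, ht, h0⟩ := F.exists_isParallelCovector_lift t x η
  rw [kappaSlice, ← ht, hα.kappa_eq, lift_restrict (h0 0)]

/-- Extend `η` to a parallel covector `α` and the spinor `v` at time 0 to a parallel spinor `u`.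
Clifford multiplication of `u` by `α` is parallel, and transporting its value at time `t` to time 0
gives both sides. -/
theorem diracBarSymbol_eq (t : ℝ) (x : N) (η : TangentSpace (𝓡 3) x →L[ℝ] ℝ) :
    F.diracBarSymbol t x η = F.diracSymbol 0 x (F.kappaSlice t x η) := by
  obtain ⟨α, hα, ht, h0⟩ := F.exists_isParallelCovector_lift t x η
  refine LinearMap.ext fun v => ?_
  obtain ⟨u, hu, rfl⟩ := F.exists_isParallelSpinor x 0 v
  have hw := IsParallelSpinor.slash hα h0 hu
  have h1 := hw.spinTransport_eq 0 t
  rw [diracBarSymbol, LinearMap.comp_apply, LinearMap.comp_apply, spinTransportₗ_apply,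
    spinTransportₗ_apply, hu.spinTransport_eq, kappaSlice, ← ht, hα.kappa_eq]
  rw [ht] at h1
  exact h1

end Framing

end Splitting

end Spacetime

end DiracReduction

theorem lemma3p2 {N : Type*} [TopologicalSpace N] [T2Space N] [SecondCountableTopology N]
    [ChartedSpace DiracReduction.E3 N] [IsManifold (𝓡 3) ∞ N]
    (S : DiracReduction.Splitting N) (F : S.Framing) (t : ℝ) :
    -- `V_t` is invertible, with the inverse used in the definition of `V_t D̂_t V_t⁻¹`
    Function.LeftInverse (F.VInv t) (F.V t) ∧ Function.RightInverse (F.VInv t) (F.V t) ∧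
    -- `κ_{0,t}` maps `T*Σ_t` to `T*Σ_0`
    (∀ (x : N) (η : TangentSpace (𝓡 3) x →L[ℝ] ℝ),
      DiracReduction.Splitting.Framing.liftCovector 0 x (F.kappaSlice t x η)
        = F.kappa 0 t x (DiracReduction.Splitting.Framing.liftCovector t x η)) ∧
    -- `D̂_0` and `V_t D̂_t V_t⁻¹` have principal symbols, and these are related by `κ_{0,t}`
    ∃ σHat σBar : ∀ x : N, (TangentSpace (𝓡 3) x →L[ℝ] ℝ) →
        (DiracReduction.Spinor →ₗ[ℂ] DiracReduction.Spinor),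
      DiracReduction.HasPrincipalSymbol (𝓡 3) (F.dirac 0) σHat ∧
      DiracReduction.HasPrincipalSymbol (𝓡 3) (F.diracBar t) σBar ∧
      ∀ (x : N) (η : TangentSpace (𝓡 3) x →L[ℝ] ℝ),
        σBar x η = σHat x (F.kappaSlice t x η) :=
  ⟨F.leftInverse_VInv t, F.rightInverse_VInv t, F.lift_kappaSlice t, F.diracSymbol 0,
    F.diracBarSymbol t, F.hasPrincipalSymbol_dirac 0, F.hasPrincipalSymbol_diracBar t,
    F.diracBarSymbol_eq t⟩
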